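/- There is a universal constant $C>0$ such that the following holds. Let $T$ be a nonempty finite set and let $(X_x)_{x\in T}$ be a centered Gaussian process, with its natural metric $d(x,y)=(\mathbf{E}|X_x-X_y|^2)^{1/2}$ on $T$ (a pseudometric if $d(x,y)=0$ for some $x\neq y$, which is allowed). Then $$\gamma_2(T)\le C\,\mathbf{E}\Big[\sup_{x\in T}X_x\Big],\qquad\text{where}\qquad \gamma_2(T):=\inf_{(\mathcal{A}_n)}\ \sup_{x\in T}\ \sum_{n\ge 0}2^{n/2}\,\mathrm{diam}(A_n(x)).$$ Here the infimum is over all sequences $(\mathcal{A}_n)_{n\ge 0}$ of partitions of $T$ such that $\mathcal{A}_{n+1}$ refines $\mathcal{A}_n$ and $|\mathcal{A}_n|<2^{2^n}$ for all $n\ge 0$; $A_n(x)$ is the element of $\mathcal{A}_n$ that contains $x$, and $\mathrm{diam}$ is the diameter with respect to $d$. -/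

import Mathlib

open MeasureTheory ProbabilityTheory
open scoped ENNReal

noncomputable section

namespace GenericChaining

/-- The diameter of `A` with respect to the distance function `d`, with values in `[0, ∞]`. -/
def diam {T : Type*} (d : T → T → ℝ) (A : Set T) : ℝ≥0∞ :=
  ⨆ x ∈ A, ⨆ y ∈ A, ENNReal.ofReal (d x y)

/-- An admissible sequence of `T`: an increasing sequence of partitions of `T`, the `n`-th of
which has fewer than `2 ^ 2 ^ n` elements. A partition is given by its equivalence relation, whose
classes are the elements of the partition; `r ≤ s` in `Setoid T` means that the partition of `r`
refines that of `s`, so that `Antitone` says that the partitions get finer with `n`. -/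
structure IsAdmissible {T : Type*} (𝒜 : ℕ → Setoid T) : Prop where
  antitone : Antitone 𝒜
  card_lt : ∀ n, (𝒜 n).classes.encard < 2 ^ 2 ^ n

/-- `A_n(x)`, the unique element of the `n`-th partition that contains `x`. -/
def cell {T : Type*} (𝒜 : ℕ → Setoid T) (n : ℕ) (x : T) : Set T :=
  {y | (𝒜 n) y x}

/-- The chaining functional `γ_{α,p}(T, d)`, with values in `[0, ∞]`. -/
def chainingFunctional {T : Type*} (d : T → T → ℝ) (α p : ℝ) : ℝ≥0∞ :=
  (⨅ (𝒜 : ℕ → Setoid T) (_ : IsAdmissible 𝒜),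
    ⨆ x, ∑' n : ℕ, ((2 : ℝ≥0∞) ^ ((n : ℝ) / α) * diam d (cell 𝒜 n x)) ^ p) ^ (1 / p)

/-- `γ_2(T, d) = γ_{2,1}(T, d)`. -/
def gammaTwo {T : Type*} (d : T → T → ℝ) : ℝ≥0∞ :=
  chainingFunctional d 2 1

/-- The natural (pseudo)metric `d(x, y) = (E|X_x - X_y|²)^{1/2}` of a process. -/
def naturalDist {T Ω : Type*} [MeasurableSpace Ω] (P : Measure Ω) (X : T → Ω → ℝ) (x y : T) : ℝ :=
  Real.sqrt (∫ ω, |X x ω - X y ω| ^ 2 ∂P)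

/-- The Gaussian width `G(A) = E[sup_{x ∈ A} X_x]`. -/
def gaussianWidth {T Ω : Type*} [MeasurableSpace Ω] (P : Measure Ω) (X : T → Ω → ℝ)
    (A : Set T) : ℝ :=
  ∫ ω, ⨆ x : A, X x ω ∂P

end GenericChaining

end

/-!
The Gaussian width bounds `γ₂` from above through two independent facts.

The probabilistic one is the growth condition `gaussianWidth_growth`: if the centres `c i` are at
mutual distance at least `r` and `H i` lies within `r / 8` of `c i`, then the width of `⋃ H i`
exceeds the smallest width of the `H i` by `r / 8` times the expected maximum of independent
standard Gaussians, one for each `i`. Indeed, take independent copies of the increments of the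
process on the clusters `H i` and add an independent `(r / 8) gᵢ` on the `i`-th one. The new process
has smaller increments than the original one, hence a smaller expected supremum by the
Sudakov-Fernique inequality (`integral_iSup_le_of_increments_le`); conditionally on `g`, its
expected supremum is at least the smallest width plus `(r / 8) max gᵢ`. The Sudakov-Fernique inequality
is proved by interpolation: the expected smooth maximum decreases along `cos θ X + sin θ Y`, since
Gaussian integration by parts (`integral_mul_comp_eq_integral_fderiv`) turns its derivative into an
expression with a sign. The maximum of `2 ^ 2 ^ n` independent Gaussians is at least of order
`2 ^ (n / 2)` (`gaussianMaxConst_mul_le`).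

The deterministic one is the contraction principle `gammaTwo_le_of_separated_card_le`. Suppose that
no set `A` contains more than `2 ^ 2 ^ n` points at mutual distance larger than
`diam A / 12 + 8 sup_A s n`. Starting from any admissible sequence, split each cell of the `n`-th
partition by the dyadic level of `s n`, and then by a maximal separated set. The chaining sum of the
result is at most half of the original one plus multiples of `sup_x ∑ 2 ^ (n / 2) s n x` and of the
diameter. As `γ₂` is finite for a finite index set, it is bounded by these two quantities.

The two are joined by interpolation. Let `s n x` minimize `κ 2 ^ (n / 2) t - G(B(x, t))` over radii
`t ≥ 0`, where `G` is the Gaussian width. The minima increase with `n` within a range of length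
`G(T)`, so their increments telescope to `∑ 2 ^ (n / 2) s n x ≲ G(T)` (`sum_minimizing_radius_le`).
If too many points of `A` were separated at the scale `diam A / 12 + 8 sup_A s n`, the growth
condition for the balls `B(x, s n x)` around them would contradict minimality
(`card_le_of_separated`).
-/

noncomputable section

namespace GenericChaining

/-! ### Gaussian integration by parts -/

/-- One-dimensional Gaussian integration by parts. -/
lemma integral_id_mul_gaussianReal (v : NNReal) {f f' : ℝ → ℝ} {B B' : ℝ}
    (hf : ∀ x, HasDerivAt f (f' x) x) (hf'c : Continuous f') (hB : ∀ x, |f x| ≤ B)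
    (hB' : ∀ x, |f' x| ≤ B') :
    ∫ x, x * f x ∂gaussianReal 0 v = v * ∫ x, f' x ∂gaussianReal 0 v := by
  rcases eq_or_ne v 0 with rfl | hv
  · simp
  have hv' : (v : ℝ) ≠ 0 := by exact_mod_cast hv
  have hfc : Continuous f := continuous_iff_continuousAt.2 fun x => (hf x).continuousAt
  rw [integral_gaussianReal_eq_integral_smul hv, integral_gaussianReal_eq_integral_smul hv]
  simp only [smul_eq_mul]
  have hg (x : ℝ) : HasDerivAt (gaussianPDFReal 0 v) (gaussianPDFReal 0 v x * (-x / v)) x := by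
    have h1 : HasDerivAt (fun y : ℝ => -(y - 0) ^ 2 / (2 * v)) (-x / v) x := by
      have h2 := (((hasDerivAt_id x).sub_const 0).pow 2).neg.div_const (2 * (v : ℝ))
      refine HasDerivAt.congr_deriv h2 ?_
      simp
      field_simp
    have h3 := (h1.exp).const_mul (√(2 * Real.pi * v))⁻¹
    refine HasDerivAt.congr_deriv h3 ?_
    simp only [gaussianPDFReal]
    ring
  have hint : Integrable (fun x : ℝ => gaussianPDFReal 0 v x * x) := by
    have h1 : Integrable (fun x : ℝ => x) (gaussianReal 0 v) :=
      memLp_one_iff_integrable.1 (memLp_id_gaussianReal (μ := 0) (v := v) 1)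
    rw [gaussianReal_of_var_ne_zero 0 hv, integrable_withDensity_iff_integrable_smul'
      (measurable_gaussianPDF 0 v) (by simp [gaussianPDF])] at h1
    simpa [toReal_gaussianPDF] using h1
  have hbd {u h : ℝ → ℝ} {A : ℝ} (hu : Integrable u) (hh : Continuous h) (hA : ∀ x, |h x| ≤ A) :
      Integrable (fun x => h x * u x) :=
    hu.bdd_mul hh.aestronglyMeasurable (Filter.Eventually.of_forall hA)
  have key := integral_mul_deriv_eq_deriv_mul_of_integrable (u := f) (v := gaussianPDFReal 0 v)
    (u' := f') (v' := fun x => gaussianPDFReal 0 v x * (-x / v)) (fun x _ => hf x)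
    (fun x _ => hg x) ?_ (hbd (integrable_gaussianPDFReal 0 v) hf'c hB')
    (hbd (integrable_gaussianPDFReal 0 v) hfc hB)
  · rw [← integral_const_mul]
    have h1 : ∫ x, gaussianPDFReal 0 v x * (x * f x) =
        -v * ∫ x, f x * (gaussianPDFReal 0 v x * (-x / v)) := by
      rw [← integral_const_mul]
      congr 1; ext x
      field_simp
    rw [h1, key, ← integral_neg, ← integral_const_mul]
    congr 1; ext x; ring
  · have h4 : Integrable (fun x => gaussianPDFReal 0 v x * (-x / v)) := by
      convert hint.mul_const (-(v : ℝ)⁻¹) using 2 with x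
      field_simp
    exact hbd h4 hfc hB

section Multivariate

variable {Ω : Type*} [MeasurableSpace Ω] {P : Measure Ω} {ι : Type*} [Fintype ι]

/-- Gaussian integration by parts: `E[ξ h(Z)] = E[Dh(Z) c]`, where `c` is the vector of covariances
of `ξ` with `Z`. Writing `Z = (ξ / Var ξ) c + W` makes `W` independent of `ξ`, and the
one-dimensional formula applies conditionally on `W`. -/
lemma integral_mul_comp_eq_integral_fderiv {ξ : Ω → ℝ} {Z : Ω → ι → ℝ}
    (hG : HasGaussianLaw (fun ω => (ξ ω, Z ω)) P) (h0 : ∫ ω, ξ ω ∂P = 0)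
    {h : (ι → ℝ) → ℝ} {h' : (ι → ℝ) → (ι → ℝ) →L[ℝ] ℝ} {B B' : ℝ}
    (hh : ∀ z, HasFDerivAt h (h' z) z) (hc : Continuous h') (hB : ∀ z, |h z| ≤ B)
    (hB' : ∀ z, ‖h' z‖ ≤ B') :
    ∫ ω, ξ ω * h (Z ω) ∂P = ∫ ω, h' (Z ω) (fun j => cov[ξ, fun ω => Z ω j; P]) ∂P := by
  have := hG.isProbabilityMeasure
  have hξ : HasGaussianLaw ξ P := hG.fst
  have hZ : HasGaussianLaw Z P := hG.snd
  have hξ2 : MemLp ξ 2 P := hξ.memLp_two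
  have hZ2 (j : ι) : MemLp (fun ω => Z ω j) 2 P :=
    (hZ.map_fun (ContinuousLinearMap.proj (R := ℝ) (φ := fun _ : ι => ℝ) j)).memLp_two
  set c : ι → ℝ := fun j => cov[ξ, fun ω => Z ω j; P] with hcdef
  set v : ℝ := Var[ξ; P] with hv
  have hhc : Continuous h := continuous_iff_continuousAt.2 fun z => (hh z).continuousAt
  rcases eq_or_ne v 0 with hv0 | hv0
  · have hξ0 : ξ =ᵐ[P] 0 := by
      have := (variance_eq_integral hξ.aemeasurable).symm.trans hv0
      rw [h0] at this
      simp only [sub_zero] at this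
      rw [integral_eq_zero_iff_of_nonneg (fun ω => sq_nonneg _) hξ2.integrable_sq] at this
      filter_upwards [this] with ω hω
      simpa using hω
    have hc0 : c = 0 := by
      ext j
      simp only [hcdef, Pi.zero_apply]
      rw [covariance_eq_sub hξ2 (hZ2 j), h0, zero_mul, sub_zero]
      apply integral_eq_zero_of_ae
      filter_upwards [hξ0] with ω hω
      simp [hω]
    rw [hc0]
    simp only [map_zero, integral_zero]
    apply integral_eq_zero_of_ae
    filter_upwards [hξ0] with ω hω
    simp [hω]
  set a : ι → ℝ := v⁻¹ • c with ha
  set W : Ω → ι → ℝ := fun ω => Z ω - ξ ω • a with hW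
  have hpair : HasGaussianLaw (fun ω => ((fun _ : Unit => ξ ω), fun j => W ω j)) P := by
    let L : ℝ × (ι → ℝ) →L[ℝ] (Unit → ℝ) × (ι → ℝ) :=
      (ContinuousLinearMap.pi fun _ => ContinuousLinearMap.fst ℝ ℝ (ι → ℝ)).prod
        (ContinuousLinearMap.snd ℝ ℝ (ι → ℝ) -
          (ContinuousLinearMap.fst ℝ ℝ (ι → ℝ)).smulRight a)
    exact hG.map_fun L
  have hWm : AEMeasurable W P := hpair.snd.aemeasurable
  have hind : IndepFun ξ W P := by
    have h1 : IndepFun (fun ω (_ : Unit) => ξ ω) (fun ω j => W ω j) P := by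
      refine HasGaussianLaw.indepFun_of_covariance_eval hpair fun _ j => ?_
      have h2 : (fun ω => W ω j) = (fun ω => Z ω j) - fun ω => ξ ω * a j := by
        ext ω; simp [hW]
      rw [h2, covariance_sub_right hξ2 (hZ2 j) (hξ2.mul_const _), covariance_mul_const_right,
        covariance_self hξ.aemeasurable]
      simp only [ha, Pi.smul_apply, smul_eq_mul, hcdef, ← hv]
      field_simp
      ring
    exact h1.comp (φ := fun f : Unit → ℝ => f ()) (ψ := id) (measurable_pi_apply _) measurable_id
  have hlaw := (indepFun_iff_map_prod_eq_prod_map_map hξ.aemeasurable hWm).1 hind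
  have hPW : IsProbabilityMeasure (P.map W) := Measure.isProbabilityMeasure_map hWm
  have hξlaw := hξ.map_eq_gaussianReal
  rw [h0, ← hv] at hξlaw
  have hv' : ((v.toNNReal : NNReal) : ℝ) = v := Real.coe_toNNReal _ (variance_nonneg _ _)
  have hm : AEMeasurable (fun ω => (ξ ω, W ω)) P := hξ.aemeasurable.prodMk hWm
  have hZeq (ω : Ω) : Z ω = W ω + ξ ω • a := by simp [hW]
  have hidint : Integrable (fun x : ℝ => x) (gaussianReal 0 v.toNNReal) :=
    memLp_one_iff_integrable.1 (memLp_id_gaussianReal (μ := 0) (v := v.toNNReal) 1)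
  have hcomp : Continuous fun p : ℝ × (ι → ℝ) => p.2 + p.1 • a := by fun_prop
  have h'bd (z : ι → ℝ) : |h' z a| ≤ B' * ‖a‖ :=
    ((h' z).le_opNorm a).trans (mul_le_mul_of_nonneg_right (hB' z) (norm_nonneg _))
  have hi1 : Integrable (fun p : ℝ × (ι → ℝ) => p.1 * h (p.2 + p.1 • a))
      ((gaussianReal 0 v.toNNReal).prod (P.map W)) := by
    refine Integrable.mul_bdd (c := B) (hidint.comp_fst _) ?_
      (Filter.Eventually.of_forall fun p => hB _)
    exact (hhc.comp hcomp).aestronglyMeasurable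
  have hi2 : Integrable (fun p : ℝ × (ι → ℝ) => h' (p.2 + p.1 • a) a)
      ((gaussianReal 0 v.toNNReal).prod (P.map W)) := by
    refine Integrable.of_bound (C := B' * ‖a‖) ?_ (Filter.Eventually.of_forall fun p => h'bd _)
    exact ((hc.comp hcomp).clm_apply continuous_const).aestronglyMeasurable
  have e1 : ∫ ω, ξ ω * h (Z ω) ∂P =
      ∫ p : ℝ × (ι → ℝ), p.1 * h (p.2 + p.1 • a) ∂((gaussianReal 0 v.toNNReal).prod (P.map W)) := by
    rw [← hξlaw, ← hlaw, integral_map hm]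
    · simp_rw [← hZeq]
    · rw [hlaw, hξlaw]; exact hi1.aestronglyMeasurable
  have e2 : ∫ ω, h' (Z ω) a ∂P =
      ∫ p : ℝ × (ι → ℝ), h' (p.2 + p.1 • a) a ∂((gaussianReal 0 v.toNNReal).prod (P.map W)) := by
    rw [← hξlaw, ← hlaw, integral_map hm]
    · simp_rw [← hZeq]
    · rw [hlaw, hξlaw]; exact hi2.aestronglyMeasurable
  have e3 : ∫ ω, h' (Z ω) c ∂P = v * ∫ ω, h' (Z ω) a ∂P := by
    rw [← integral_const_mul]
    congr 1; ext ω
    rw [ha, map_smul, smul_eq_mul, ← mul_assoc, mul_inv_cancel₀ hv0, one_mul]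
  rw [e1, e3, e2, integral_prod_symm _ hi1, integral_prod_symm _ hi2, ← integral_const_mul]
  congr 1; ext w
  have := integral_id_mul_gaussianReal v.toNNReal (f := fun x => h (w + x • a))
    (f' := fun x => h' (w + x • a) a) (B := B) (B' := B' * ‖a‖) (fun x => ?_)
    ((hc.comp (by fun_prop : Continuous fun x : ℝ => w + x • a)).clm_apply continuous_const)
    (fun x => hB _) (fun x => h'bd _)
  · rw [this, hv']
  · have h5 : HasDerivAt (fun x : ℝ => w + x • a) a x := by
      simpa using ((hasDerivAt_id x).smul_const a).const_add w
    exact (hh _).comp_hasDerivAt x h5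

end Multivariate

/-! ### The smooth maximum -/

section SmoothMax

variable {ι : Type*} [Fintype ι]

/-- The smooth maximum `β⁻¹ log ∑ᵢ exp (β zᵢ)`. -/
def softMax (β : ℝ) (z : ι → ℝ) : ℝ :=
  β⁻¹ * Real.log (∑ i, Real.exp (β * z i))

/-- The Gibbs weights `exp (β zᵢ) / ∑ⱼ exp (β zⱼ)`, the partial derivatives of `softMax β`. -/
def gibbsWeight (β : ℝ) (i : ι) (z : ι → ℝ) : ℝ :=
  Real.exp (β * z i) / ∑ j, Real.exp (β * z j)

/-- The derivative of `softMax β` at `z`. -/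
def softMaxDeriv (β : ℝ) (z : ι → ℝ) : (ι → ℝ) →L[ℝ] ℝ :=
  ∑ i, gibbsWeight β i z • ContinuousLinearMap.proj (R := ℝ) (φ := fun _ : ι => ℝ) i

/-- The derivative of `gibbsWeight β i` at `z`. -/
def gibbsWeightDeriv (β : ℝ) (i : ι) (z : ι → ℝ) : (ι → ℝ) →L[ℝ] ℝ :=
  (β * gibbsWeight β i z) •
    (ContinuousLinearMap.proj (R := ℝ) (φ := fun _ : ι => ℝ) i - softMaxDeriv β z)

lemma softMaxDeriv_apply (β : ℝ) (z u : ι → ℝ) :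
    softMaxDeriv β z u = ∑ i, gibbsWeight β i z * u i := by
  simp [softMaxDeriv]

lemma gibbsWeightDeriv_apply (β : ℝ) (i : ι) (z u : ι → ℝ) :
    gibbsWeightDeriv β i z u = β * gibbsWeight β i z * (u i - ∑ j, gibbsWeight β j z * u j) := by
  simp [gibbsWeightDeriv, softMaxDeriv_apply]

lemma gibbsWeight_nonneg (β : ℝ) (i : ι) (z : ι → ℝ) : 0 ≤ gibbsWeight β i z :=
  div_nonneg (Real.exp_pos _).le (Finset.sum_nonneg fun _ _ => (Real.exp_pos _).le)

lemma hasFDerivAt_exp_mul_proj (β : ℝ) (i : ι) (z : ι → ℝ) :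
    HasFDerivAt (fun z : ι → ℝ => Real.exp (β * z i))
      ((β * Real.exp (β * z i)) • ContinuousLinearMap.proj (R := ℝ) (φ := fun _ : ι => ℝ) i) z := by
  have h1 : HasFDerivAt (fun z : ι → ℝ => β * z i)
      (β • ContinuousLinearMap.proj (R := ℝ) (φ := fun _ : ι => ℝ) i) z :=
    (hasFDerivAt_apply i z).const_mul β
  refine HasFDerivAt.congr_fderiv h1.exp ?_
  rw [smul_smul, mul_comm]

/-- For weights `p` with `∑ pᵢ = 1`,
`∑ᵢ pᵢ (cᵢᵢ - ∑ⱼ pⱼ cᵢⱼ) = ½ ∑ᵢⱼ pᵢ pⱼ (cᵢᵢ + cⱼⱼ - 2 cᵢⱼ)` so the sign of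
`cᵢᵢ + cⱼⱼ - 2 cᵢⱼ` decides that of the left-hand side. -/
lemma sum_mul_sub_nonpos {p : ι → ℝ} {c : ι → ι → ℝ} (hp : ∀ i, 0 ≤ p i) (hp1 : ∑ i, p i = 1)
    (hc : ∀ i j, c i i + c j j - 2 * c i j ≤ 0) :
    ∑ i, p i * (c i i - ∑ j, p j * c i j) ≤ 0 := by
  have h1 : ∑ i, ∑ j, p i * p j * (c i i + c j j - 2 * c i j) ≤ 0 :=
    Finset.sum_nonpos fun i _ => Finset.sum_nonpos fun j _ =>
      mul_nonpos_of_nonneg_of_nonpos (mul_nonneg (hp i) (hp j)) (hc i j)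
  have h2 : ∑ i, ∑ j, p i * p j * c i i = ∑ i, p i * c i i := by
    refine Finset.sum_congr rfl fun i _ => ?_
    rw [← Finset.sum_mul, ← Finset.mul_sum, hp1, mul_one]
  have h3 : ∑ i, ∑ j, p i * p j * c j j = ∑ i, p i * c i i := by
    rw [Finset.sum_comm, ← h2]
    exact Finset.sum_congr rfl fun i _ => Finset.sum_congr rfl fun j _ => by ring
  have h4 : ∑ i, p i * (c i i - ∑ j, p j * c i j) =
      ∑ i, p i * c i i - ∑ i, ∑ j, p i * p j * c i j := by
    rw [← Finset.sum_sub_distrib]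
    refine Finset.sum_congr rfl fun i _ => ?_
    rw [mul_sub, Finset.mul_sum]
    simp_rw [mul_assoc]
  have h5 : ∑ i, ∑ j, p i * p j * (c i i + c j j - 2 * c i j) =
      ∑ i, ∑ j, p i * p j * c i i + ∑ i, ∑ j, p i * p j * c j j
        - 2 * ∑ i, ∑ j, p i * p j * c i j := by
    simp only [Finset.mul_sum, ← Finset.sum_add_distrib, ← Finset.sum_sub_distrib]
    exact Finset.sum_congr rfl fun i _ => Finset.sum_congr rfl fun j _ => by ring
  rw [h4]
  linarith

variable [Nonempty ι]

lemma sum_exp_pos (β : ℝ) (z : ι → ℝ) : 0 < ∑ i, Real.exp (β * z i) :=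
  Finset.sum_pos (fun _ _ => Real.exp_pos _) Finset.univ_nonempty

lemma sum_gibbsWeight (β : ℝ) (z : ι → ℝ) : ∑ i, gibbsWeight β i z = 1 := by
  simp only [gibbsWeight, ← Finset.sum_div]
  exact div_self (sum_exp_pos β z).ne'

lemma gibbsWeight_le_one (β : ℝ) (i : ι) (z : ι → ℝ) : gibbsWeight β i z ≤ 1 := by
  rw [← sum_gibbsWeight β z]
  exact Finset.single_le_sum (fun j _ => gibbsWeight_nonneg β j z) (Finset.mem_univ i)

lemma continuous_gibbsWeight (β : ℝ) (i : ι) : Continuous (gibbsWeight (ι := ι) β i) := by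
  unfold gibbsWeight
  exact Continuous.div (by fun_prop) (by fun_prop) fun z => (sum_exp_pos β z).ne'

lemma continuous_softMaxDeriv (β : ℝ) : Continuous (softMaxDeriv (ι := ι) β) := by
  unfold softMaxDeriv
  exact continuous_finsetSum _ fun i _ => (continuous_gibbsWeight β i).smul continuous_const

lemma continuous_gibbsWeightDeriv (β : ℝ) (i : ι) :
    Continuous (gibbsWeightDeriv (ι := ι) β i) := by
  unfold gibbsWeightDeriv
  exact (continuous_const.mul (continuous_gibbsWeight β i)).smul
    (continuous_const.sub (continuous_softMaxDeriv β))

lemma abs_softMaxDeriv_le (β : ℝ) (z u : ι → ℝ) : |softMaxDeriv β z u| ≤ ∑ i, |u i| := by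
  rw [softMaxDeriv_apply]
  refine (Finset.abs_sum_le_sum_abs _ _).trans (Finset.sum_le_sum fun i _ => ?_)
  rw [abs_mul, abs_of_nonneg (gibbsWeight_nonneg β i z)]
  exact mul_le_of_le_one_left (abs_nonneg _) (gibbsWeight_le_one β i z)

lemma norm_softMaxDeriv_le (β : ℝ) (z : ι → ℝ) : ‖softMaxDeriv β z‖ ≤ 1 := by
  refine ContinuousLinearMap.opNorm_le_bound _ zero_le_one fun u => ?_
  rw [softMaxDeriv_apply, Real.norm_eq_abs, one_mul]
  refine (Finset.abs_sum_le_sum_abs _ _).trans ?_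
  calc ∑ i, |gibbsWeight β i z * u i| ≤ ∑ i, gibbsWeight β i z * ‖u‖ := by
        refine Finset.sum_le_sum fun i _ => ?_
        rw [abs_mul, abs_of_nonneg (gibbsWeight_nonneg β i z)]
        exact mul_le_mul_of_nonneg_left (norm_le_pi_norm u i) (gibbsWeight_nonneg β i z)
    _ = ‖u‖ := by rw [← Finset.sum_mul, sum_gibbsWeight, one_mul]

lemma norm_gibbsWeightDeriv_le (β : ℝ) (i : ι) (z : ι → ℝ) :
    ‖gibbsWeightDeriv β i z‖ ≤ |β| * 2 := by
  refine ContinuousLinearMap.opNorm_le_bound _ (by positivity) fun u => ?_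
  rw [gibbsWeightDeriv, _root_.smul_apply, norm_smul, norm_mul, Real.norm_eq_abs,
    Real.norm_eq_abs, abs_of_nonneg (gibbsWeight_nonneg β i z)]
  have h1 : ‖(ContinuousLinearMap.proj (R := ℝ) (φ := fun _ : ι => ℝ) i - softMaxDeriv β z) u‖
      ≤ 2 * ‖u‖ := by
    rw [_root_.sub_apply, ContinuousLinearMap.proj_apply]
    have h2 := (softMaxDeriv β z).le_of_opNorm_le (norm_softMaxDeriv_le β z) u
    have h3 := norm_le_pi_norm u i
    have h4 := norm_sub_le (u i) (softMaxDeriv β z u)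
    linarith
  calc |β| * gibbsWeight β i z * _ ≤ |β| * 1 * (2 * ‖u‖) :=
        mul_le_mul (mul_le_mul_of_nonneg_left (gibbsWeight_le_one β i z) (abs_nonneg _)) h1
          (norm_nonneg _) (by positivity)
    _ = _ := by ring

lemma hasFDerivAt_sum_exp (β : ℝ) (z : ι → ℝ) :
    HasFDerivAt (fun z : ι → ℝ => ∑ i, Real.exp (β * z i))
      ((β * ∑ i, Real.exp (β * z i)) • softMaxDeriv β z) z := by
  have h1 := HasFDerivAt.fun_sum (u := Finset.univ)
    fun i _ => hasFDerivAt_exp_mul_proj (ι := ι) β i z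
  refine HasFDerivAt.congr_fderiv h1 ?_
  have h2 := (sum_exp_pos β z).ne'
  rw [softMaxDeriv, Finset.smul_sum]
  refine Finset.sum_congr rfl fun i _ => ?_
  rw [smul_smul, gibbsWeight]
  congr 1
  field_simp

lemma hasFDerivAt_softMax {β : ℝ} (hβ : β ≠ 0) (z : ι → ℝ) :
    HasFDerivAt (softMax β) (softMaxDeriv β z) z := by
  have h2 := (sum_exp_pos β z).ne'
  refine HasFDerivAt.congr_fderiv (((hasFDerivAt_sum_exp β z).log h2).const_mul β⁻¹) ?_
  rw [smul_smul, smul_smul]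
  convert one_smul ℝ _
  field_simp

lemma hasFDerivAt_gibbsWeight (β : ℝ) (i : ι) (z : ι → ℝ) :
    HasFDerivAt (gibbsWeight β i) (gibbsWeightDeriv β i z) z := by
  have h2 := (sum_exp_pos β z).ne'
  have h1 := (hasFDerivAt_exp_mul_proj β i z).mul
    ((hasDerivAt_inv h2).comp_hasFDerivAt z (hasFDerivAt_sum_exp β z))
  refine HasFDerivAt.congr_fderiv h1 ?_
  ext u
  simp only [gibbsWeightDeriv, gibbsWeight, _root_.add_apply,
    _root_.smul_apply, _root_.sub_apply, smul_eq_mul, Function.comp]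
  field_simp
  ring

lemma ciSup_le_softMax {β : ℝ} (hβ : 0 < β) (z : ι → ℝ) : ⨆ i, z i ≤ softMax β z := by
  refine ciSup_le fun i => ?_
  rw [softMax, ← div_eq_inv_mul, le_div_iff₀ hβ, mul_comm, Real.le_log_iff_exp_le (sum_exp_pos β z)]
  exact Finset.single_le_sum (f := fun i => Real.exp (β * z i)) (fun j _ => (Real.exp_pos _).le)
    (Finset.mem_univ i)

lemma softMax_le_ciSup_add {β : ℝ} (hβ : 0 < β) (z : ι → ℝ) :
    softMax β z ≤ (⨆ i, z i) + β⁻¹ * Real.log (Fintype.card ι) := by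
  have hle (i : ι) : z i ≤ ⨆ i, z i := le_ciSup (Set.finite_range z).bddAbove i
  have h1 : ∑ i, Real.exp (β * z i) ≤ Fintype.card ι * Real.exp (β * ⨆ i, z i) := by
    refine (Finset.sum_le_card_nsmul _ _ (Real.exp (β * ⨆ i, z i)) fun i _ => ?_).trans ?_
    · exact Real.exp_le_exp.2 (mul_le_mul_of_nonneg_left (hle i) hβ.le)
    · simp
  have h2 := Real.log_le_log (sum_exp_pos β z) h1
  rw [Real.log_mul (by simp) (Real.exp_pos _).ne', Real.log_exp] at h2
  calc softMax β z ≤ β⁻¹ * (Real.log (Fintype.card ι) + β * ⨆ i, z i) :=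
        mul_le_mul_of_nonneg_left h2 (inv_pos.2 hβ).le
    _ = _ := by field_simp; ring

end SmoothMax

end GenericChaining

/-! ### Transfer along measure preserving maps -/

lemma MeasureTheory.MeasurePreserving.integral_comp_eq {α β : Type*} [MeasurableSpace α]
    [MeasurableSpace β] {μ : Measure α} {ν : Measure β} {g : α → β} (hg : MeasurePreserving g μ ν)
    {f : β → ℝ} (hf : AEStronglyMeasurable f ν) : ∫ a, f (g a) ∂μ = ∫ b, f b ∂ν := by
  conv_rhs => rw [← hg.map_eq]
  rw [integral_map hg.measurable.aemeasurable (by rwa [hg.map_eq])]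

lemma ProbabilityTheory.HasGaussianLaw.comp_measurePreserving {α β E : Type*} [MeasurableSpace α]
    [MeasurableSpace β] [MeasurableSpace E] [TopologicalSpace E] [AddCommMonoid E] [Module ℝ E]
    {μ : Measure α} {ν : Measure β} {X : β → E} (hX : HasGaussianLaw X ν) {g : α → β}
    (hg : MeasurePreserving g μ ν) : HasGaussianLaw (fun a => X (g a)) μ := by
  refine ⟨?_⟩
  have : μ.map (fun a => X (g a)) = ν.map X := by
    conv_rhs => rw [← hg.map_eq]
    rw [AEMeasurable.map_map_of_aemeasurable (by rw [hg.map_eq]; exact hX.aemeasurable)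
      hg.measurable.aemeasurable]
    rfl
  rw [this]
  exact hX.isGaussian_map

namespace GenericChaining

/-! ### Comparison of suprema of Gaussian vectors -/

section Comparison

variable {Ω : Type*} [MeasurableSpace Ω] {P : Measure Ω} {ι : Type*} [Fintype ι]

lemma memLp_two_apply_of_hasGaussianLaw {X : Ω → ι → ℝ} (hX : HasGaussianLaw X P) (i : ι) :
    MemLp (fun ω => X ω i) 2 P :=
  (hX.map_fun (ContinuousLinearMap.proj (R := ℝ) (φ := fun _ : ι => ℝ) i)).memLp_two

lemma integrable_iSup_apply [Nonempty ι] {X : Ω → ι → ℝ} (hX : ∀ i, Integrable (fun ω => X ω i) P) :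
    Integrable (fun ω => ⨆ i, X ω i) P := by
  have hsum : Integrable (fun ω => ∑ i, |X ω i|) P := integrable_finsetSum _ fun i _ => (hX i).abs
  refine hsum.mono' ?_ (Filter.Eventually.of_forall fun ω => ?_)
  · exact (AEMeasurable.iSup fun i => (hX i).aemeasurable).aestronglyMeasurable
  · have hb : ∀ i, |X ω i| ≤ ∑ i, |X ω i| := fun i =>
      Finset.single_le_sum (f := fun i => |X ω i|) (fun j _ => abs_nonneg _) (Finset.mem_univ i)
    obtain ⟨i, hi⟩ := exists_eq_ciSup_of_finite (f := X ω)
    rw [← hi]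
    exact hb i

variable [Nonempty ι]

lemma integrable_softMax {β : ℝ} (hβ : 0 < β) {X : Ω → ι → ℝ} [IsFiniteMeasure P]
    (hX : ∀ i, Integrable (fun ω => X ω i) P) :
    Integrable (fun ω => softMax β (X ω)) P := by
  have hm : AEStronglyMeasurable (fun ω => softMax β (X ω)) P := by
    have hc : Continuous (softMax (ι := ι) β) :=
      continuous_iff_continuousAt.2 fun z => (hasFDerivAt_softMax hβ.ne' z).continuousAt
    exact (hc.measurable.comp_aemeasurable
      (aemeasurable_pi_lambda _ fun i => (hX i).aemeasurable)).aestronglyMeasurable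
  refine integrable_of_le_of_le hm (Filter.Eventually.of_forall fun ω => ciSup_le_softMax hβ _)
    (Filter.Eventually.of_forall fun ω => softMax_le_ciSup_add hβ _) (integrable_iSup_apply hX) ?_
  exact (integrable_iSup_apply hX).add (integrable_const _)

/-- The expected smooth maximum decreases along the path `cos θ • X + sin θ • Y` between
independent centred Gaussian vectors whenever the increments of `Y` are smaller than those
of `X`. -/
lemma integral_softMax_le {X Y : Ω → ι → ℝ} (hXY : HasGaussianLaw (fun ω => (X ω, Y ω)) P)
    (hX0 : ∀ i, ∫ ω, X ω i ∂P = 0) (hY0 : ∀ i, ∫ ω, Y ω i ∂P = 0)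
    (hcov : ∀ i j, cov[fun ω => X ω i, fun ω => Y ω j; P] = 0)
    (h : ∀ i j, ∫ ω, (Y ω i - Y ω j) ^ 2 ∂P ≤ ∫ ω, (X ω i - X ω j) ^ 2 ∂P) {β : ℝ} (hβ : 0 < β) :
    ∫ ω, softMax β (Y ω) ∂P ≤ ∫ ω, softMax β (X ω) ∂P := by
  have := hXY.isProbabilityMeasure
  have hX2 := memLp_two_apply_of_hasGaussianLaw hXY.fst
  have hY2 := memLp_two_apply_of_hasGaussianLaw hXY.snd
  have hXi (i : ι) : Integrable (fun ω => X ω i) P := (hX2 i).integrable one_le_two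
  have hYi (i : ι) : Integrable (fun ω => Y ω i) P := (hY2 i).integrable one_le_two
  set Z : ℝ → Ω → ι → ℝ := fun θ ω => Real.cos θ • X ω + Real.sin θ • Y ω with hZ
  set Z' : ℝ → Ω → ι → ℝ := fun θ ω => (-Real.sin θ) • X ω + Real.cos θ • Y ω with hZ'
  have hZi (θ : ℝ) (i : ι) : Integrable (fun ω => Z θ ω i) P :=
    ((hXi i).const_mul (Real.cos θ)).add ((hYi i).const_mul (Real.sin θ))
  have hZ'i (θ : ℝ) (i : ι) : Integrable (fun ω => Z' θ ω i) P :=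
    ((hXi i).const_mul (-Real.sin θ)).add ((hYi i).const_mul (Real.cos θ))
  have hZm (θ : ℝ) : AEMeasurable (Z θ) P :=
    aemeasurable_pi_lambda _ fun i => (hZi θ i).aemeasurable
  have hZ'm (θ : ℝ) : AEMeasurable (Z' θ) P :=
    aemeasurable_pi_lambda _ fun i => (hZ'i θ i).aemeasurable
  set bound : Ω → ℝ := fun ω => ∑ i, (|X ω i| + |Y ω i|) with hbound
  have hbi : Integrable bound P :=
    integrable_finsetSum _ fun i _ => (hXi i).abs.add (hYi i).abs
  -- Differentiation under the integral sign.
  have hder (θ : ℝ) : HasDerivAt (fun θ => ∫ ω, softMax β (Z θ ω) ∂P)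
      (∫ ω, softMaxDeriv β (Z θ ω) (Z' θ ω) ∂P) θ := by
    refine (hasDerivAt_integral_of_dominated_loc_of_deriv_le (bound := bound)
      (F' := fun θ ω => softMaxDeriv β (Z θ ω) (Z' θ ω)) Filter.univ_mem
      (Filter.Eventually.of_forall fun θ => (integrable_softMax hβ (hZi θ)).aestronglyMeasurable)
      (integrable_softMax hβ (hZi θ)) ?_ (Filter.Eventually.of_forall fun ω θ _ => ?_) hbi
      (Filter.Eventually.of_forall fun ω θ _ => ?_)).2
    · have hc : Continuous fun q : (ι → ℝ) × (ι → ℝ) => softMaxDeriv β q.1 q.2 :=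
        ((continuous_softMaxDeriv β).comp continuous_fst).clm_apply continuous_snd
      exact (hc.measurable.comp_aemeasurable ((hZm θ).prodMk (hZ'm θ))).aestronglyMeasurable
    · refine (abs_softMaxDeriv_le β _ _).trans (Finset.sum_le_sum fun i _ => ?_)
      have h1 : |Z' θ ω i| ≤ |(-Real.sin θ) * X ω i| + |Real.cos θ * Y ω i| := abs_add_le _ _
      refine h1.trans (add_le_add ?_ ?_)
      · rw [abs_mul, abs_neg]
        exact mul_le_of_le_one_left (abs_nonneg _) (Real.abs_sin_le_one θ)
      · rw [abs_mul]
        exact mul_le_of_le_one_left (abs_nonneg _) (Real.abs_cos_le_one θ)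
    · have h1 : HasDerivAt (fun θ => Z θ ω) (Z' θ ω) θ :=
        ((Real.hasDerivAt_cos θ).smul_const (X ω)).add ((Real.hasDerivAt_sin θ).smul_const (Y ω))
      exact (hasFDerivAt_softMax hβ.ne' (Z θ ω)).comp_hasDerivAt θ h1
  have hcovZ (θ : ℝ) (i j : ι) : cov[fun ω => Z' θ ω i, fun ω => Z θ ω j; P] =
      Real.sin θ * Real.cos θ * (cov[fun ω => Y ω i, fun ω => Y ω j; P]
        - cov[fun ω => X ω i, fun ω => X ω j; P]) := by
    have e1 : (fun ω => Z' θ ω i) =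
        (fun ω => -Real.sin θ * X ω i) + fun ω => Real.cos θ * Y ω i := by ext ω; simp [hZ']
    have e2 : (fun ω => Z θ ω j) =
        (fun ω => Real.cos θ * X ω j) + fun ω => Real.sin θ * Y ω j := by ext ω; simp [hZ]
    rw [e1, e2, covariance_add_left ((hX2 i).const_mul _) ((hY2 i).const_mul _)
        (((hX2 j).const_mul _).add ((hY2 j).const_mul _)),
      covariance_add_right ((hX2 i).const_mul _) ((hX2 j).const_mul _) ((hY2 j).const_mul _),
      covariance_add_right ((hY2 i).const_mul _) ((hX2 j).const_mul _) ((hY2 j).const_mul _)]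
    simp only [covariance_const_mul_left, covariance_const_mul_right]
    rw [hcov i j, covariance_comm (fun ω => Y ω i), hcov j i]
    ring
  have hsq {V : Ω → ι → ℝ} (hV : ∀ i, MemLp (fun ω => V ω i) 2 P)
      (hV0 : ∀ i, ∫ ω, V ω i ∂P = 0) (i j : ι) : ∫ ω, (V ω i - V ω j) ^ 2 ∂P =
        cov[fun ω => V ω i, fun ω => V ω i; P] + cov[fun ω => V ω j, fun ω => V ω j; P]
          - 2 * cov[fun ω => V ω i, fun ω => V ω j; P] := by
    have hmul (i j : ι) : Integrable (fun ω => V ω i * V ω j) P := (hV i).integrable_mul (hV j)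
    have hc (i j : ι) : cov[fun ω => V ω i, fun ω => V ω j; P] = ∫ ω, V ω i * V ω j ∂P := by
      rw [covariance_eq_sub (hV i) (hV j), hV0 i, zero_mul, sub_zero]
      rfl
    have hadd : Integrable (fun ω => V ω i * V ω i + V ω j * V ω j) P := (hmul i i).add (hmul j j)
    rw [hc, hc, hc, ← integral_add (hmul i i) (hmul j j), ← integral_const_mul,
      ← integral_sub hadd ((hmul i j).const_mul 2)]
    congr 1; ext ω; ring
  -- Integration by parts turns the derivative into an expression with a sign.
  have hneg (θ : ℝ) (hsc : 0 ≤ Real.sin θ * Real.cos θ) :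
      ∫ ω, softMaxDeriv β (Z θ ω) (Z' θ ω) ∂P ≤ 0 := by
    set c : ι → ι → ℝ := fun i j => cov[fun ω => Z' θ ω i, fun ω => Z θ ω j; P] with hcdef
    have hIBP (i : ι) : ∫ ω, Z' θ ω i * gibbsWeight β i (Z θ ω) ∂P =
        ∫ ω, gibbsWeightDeriv β i (Z θ ω) (c i) ∂P := by
      refine integral_mul_comp_eq_integral_fderiv (B := 1) (B' := |β| * 2) ?_ ?_
        (hasFDerivAt_gibbsWeight β i) (continuous_gibbsWeightDeriv β i) (fun z => ?_)
        (norm_gibbsWeightDeriv_le β i)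
      · let L : (ι → ℝ) × (ι → ℝ) →L[ℝ] ℝ × (ι → ℝ) :=
          ((ContinuousLinearMap.proj (R := ℝ) (φ := fun _ : ι => ℝ) i).comp
            ((-Real.sin θ) • ContinuousLinearMap.fst ℝ (ι → ℝ) (ι → ℝ) +
              Real.cos θ • ContinuousLinearMap.snd ℝ (ι → ℝ) (ι → ℝ))).prod
            (Real.cos θ • ContinuousLinearMap.fst ℝ (ι → ℝ) (ι → ℝ) +
              Real.sin θ • ContinuousLinearMap.snd ℝ (ι → ℝ) (ι → ℝ))
        exact hXY.map_fun L
      · have : ∫ ω, (-Real.sin θ * X ω i + Real.cos θ * Y ω i) ∂P = 0 := by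
          rw [integral_add ((hXi i).const_mul _) ((hYi i).const_mul _), integral_const_mul,
            integral_const_mul, hX0, hY0]
          simp
        exact this
      · rw [abs_of_nonneg (gibbsWeight_nonneg β i z)]
        exact gibbsWeight_le_one β i z
    have hi1 (i : ι) : Integrable (fun ω => Z' θ ω i * gibbsWeight β i (Z θ ω)) P := by
      refine (hZ'i θ i).mul_bdd (c := 1)
        ((continuous_gibbsWeight β i).measurable.comp_aemeasurable (hZm θ)).aestronglyMeasurable
        (Filter.Eventually.of_forall fun ω => ?_)
      rw [Real.norm_eq_abs, abs_of_nonneg (gibbsWeight_nonneg β i _)]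
      exact gibbsWeight_le_one β i _
    have hi2 (i : ι) : Integrable (fun ω => gibbsWeightDeriv β i (Z θ ω) (c i)) P := by
      have hc : Continuous fun z : ι → ℝ => gibbsWeightDeriv β i z (c i) :=
        (continuous_gibbsWeightDeriv β i).clm_apply continuous_const
      refine Integrable.of_bound (C := |β| * 2 * ‖c i‖)
        (hc.measurable.comp_aemeasurable (hZm θ)).aestronglyMeasurable
        (Filter.Eventually.of_forall fun ω => ?_)
      exact (gibbsWeightDeriv β i (Z θ ω)).le_of_opNorm_le (norm_gibbsWeightDeriv_le β i _) _
    have e1 : ∫ ω, softMaxDeriv β (Z θ ω) (Z' θ ω) ∂P =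
        ∫ ω, ∑ i, gibbsWeightDeriv β i (Z θ ω) (c i) ∂P := by
      rw [integral_finsetSum _ fun i _ => hi2 i, ← Finset.sum_congr rfl fun i _ => hIBP i,
        ← integral_finsetSum _ fun i _ => hi1 i]
      congr 1; ext ω
      rw [softMaxDeriv_apply]
      exact Finset.sum_congr rfl fun i _ => mul_comm _ _
    rw [e1]
    refine integral_nonpos fun ω => ?_
    have e2 : ∑ i, gibbsWeightDeriv β i (Z θ ω) (c i) = β * ∑ i, gibbsWeight β i (Z θ ω) *
        (c i i - ∑ j, gibbsWeight β j (Z θ ω) * c i j) := by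
      rw [Finset.mul_sum]
      exact Finset.sum_congr rfl fun i _ => by rw [gibbsWeightDeriv_apply, mul_assoc]
    simp only [e2]
    refine mul_nonpos_of_nonneg_of_nonpos hβ.le
      (sum_mul_sub_nonpos (fun i => gibbsWeight_nonneg β i _) (sum_gibbsWeight β _) fun i j => ?_)
    have e3 : c i i + c j j - 2 * c i j = Real.sin θ * Real.cos θ *
        (∫ ω, (Y ω i - Y ω j) ^ 2 ∂P - ∫ ω, (X ω i - X ω j) ^ 2 ∂P) := by
      rw [hsq hX2 hX0, hsq hY2 hY0]
      simp only [hcdef, hcovZ]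
      ring
    rw [e3]
    exact mul_nonpos_of_nonneg_of_nonpos hsc (sub_nonpos.2 (h i j))
  have hanti : AntitoneOn (fun θ => ∫ ω, softMax β (Z θ ω) ∂P) (Set.Icc 0 (Real.pi / 2)) := by
    refine antitoneOn_of_deriv_nonpos (convex_Icc _ _)
      (fun θ _ => (hder θ).continuousAt.continuousWithinAt)
      (fun θ _ => (hder θ).differentiableAt.differentiableWithinAt) fun θ hθ => ?_
    rw [(hder θ).deriv]
    rw [interior_Icc] at hθ
    have hpi := Real.pi_pos
    exact hneg θ (mul_nonneg (Real.sin_nonneg_of_nonneg_of_le_pi hθ.1.le (by linarith [hθ.2]))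
      (Real.cos_nonneg_of_neg_pi_div_two_le_of_le (by linarith [hθ.1]) hθ.2.le))
  have hpi : 0 ≤ Real.pi / 2 := by positivity
  have := hanti (Set.left_mem_Icc.2 hpi) (Set.right_mem_Icc.2 hpi) hpi
  simpa [hZ] using this

/-- The **Sudakov-Fernique inequality**: a centred Gaussian vector with larger increments has the
larger expected maximum. -/
theorem integral_iSup_le_of_increments_le {Ω' : Type*} [MeasurableSpace Ω'] {P' : Measure Ω'}
    {X : Ω → ι → ℝ} {Y : Ω' → ι → ℝ} (hX : HasGaussianLaw X P) (hY : HasGaussianLaw Y P')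
    (hX0 : ∀ i, ∫ ω, X ω i ∂P = 0) (hY0 : ∀ i, ∫ ω, Y ω i ∂P' = 0)
    (h : ∀ i j, ∫ ω, (Y ω i - Y ω j) ^ 2 ∂P' ≤ ∫ ω, (X ω i - X ω j) ^ 2 ∂P) :
    ∫ ω, ⨆ i, Y ω i ∂P' ≤ ∫ ω, ⨆ i, X ω i ∂P := by
  have := hX.isProbabilityMeasure
  have := hY.isProbabilityMeasure
  have hXi (i : ι) : Integrable (fun ω => X ω i) P :=
    (memLp_two_apply_of_hasGaussianLaw hX i).integrable one_le_two
  have hYi (i : ι) : Integrable (fun ω => Y ω i) P' :=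
    (memLp_two_apply_of_hasGaussianLaw hY i).integrable one_le_two
  have hfst : MeasurePreserving Prod.fst (P.prod P') P := measurePreserving_fst
  have hsnd : MeasurePreserving Prod.snd (P.prod P') P' := measurePreserving_snd
  have hf {f : Ω → ℝ} (hf : AEStronglyMeasurable f P) :
      ∫ q, f q.1 ∂(P.prod P') = ∫ ω, f ω ∂P := hfst.integral_comp_eq hf
  have hg {f : Ω' → ℝ} (hf : AEStronglyMeasurable f P') :
      ∫ q, f q.2 ∂(P.prod P') = ∫ ω, f ω ∂P' := hsnd.integral_comp_eq hf
  have hind : IndepFun (fun q : Ω × Ω' => X q.1) (fun q => Y q.2) (P.prod P') :=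
    indepFun_prod₀ hX.aemeasurable hY.aemeasurable
  have hX' : HasGaussianLaw (fun q : Ω × Ω' => X q.1) (P.prod P') := hX.comp_measurePreserving hfst
  have hY' : HasGaussianLaw (fun q : Ω × Ω' => Y q.2) (P.prod P') := hY.comp_measurePreserving hsnd
  have hsoft {β : ℝ} (hβ : 0 < β) :
      ∫ ω, softMax β (Y ω) ∂P' ≤ ∫ ω, softMax β (X ω) ∂P := by
    have key := integral_softMax_le (X := fun q : Ω × Ω' => X q.1)
      (Y := fun q : Ω × Ω' => Y q.2) (hind.hasGaussianLaw hX' hY')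
      (fun i => (hf (hXi i).aestronglyMeasurable).trans (hX0 i))
      (fun i => (hg (hYi i).aestronglyMeasurable).trans (hY0 i)) (fun i j => ?_) (fun i j => ?_) hβ
    · rwa [hf (integrable_softMax hβ hXi).aestronglyMeasurable,
        hg (integrable_softMax hβ hYi).aestronglyMeasurable] at key
    · have hij : IndepFun (fun q : Ω × Ω' => X q.1 i) (fun q => Y q.2 j) (P.prod P') :=
        hind.comp (φ := fun z : ι → ℝ => z i) (ψ := fun z : ι → ℝ => z j)
          (measurable_pi_apply i) (measurable_pi_apply j)
      exact hij.covariance_eq_zero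
        (memLp_two_apply_of_hasGaussianLaw hX' i) (memLp_two_apply_of_hasGaussianLaw hY' j)
    · have e1 := hf (f := fun ω => (X ω i - X ω j) ^ 2)
        (((hXi i).sub (hXi j)).aestronglyMeasurable.pow 2)
      have e2 := hg (f := fun ω => (Y ω i - Y ω j) ^ 2)
        (((hYi i).sub (hYi j)).aestronglyMeasurable.pow 2)
      rw [e1, e2]
      exact h i j
  have hβ {β : ℝ} (hβ : 0 < β) :
      ∫ ω, ⨆ i, Y ω i ∂P' ≤ ∫ ω, ⨆ i, X ω i ∂P + β⁻¹ * Real.log (Fintype.card ι) := by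
    calc ∫ ω, ⨆ i, Y ω i ∂P' ≤ ∫ ω, softMax β (Y ω) ∂P' :=
          integral_mono (integrable_iSup_apply hYi) (integrable_softMax hβ hYi)
            fun ω => ciSup_le_softMax hβ _
      _ ≤ ∫ ω, softMax β (X ω) ∂P := hsoft hβ
      _ ≤ ∫ ω, ((⨆ i, X ω i) + β⁻¹ * Real.log (Fintype.card ι)) ∂P :=
          integral_mono (integrable_softMax hβ hXi)
            ((integrable_iSup_apply hXi).add (integrable_const _))
            fun ω => softMax_le_ciSup_add hβ _
      _ = _ := by rw [integral_add (integrable_iSup_apply hXi) (integrable_const _)]; simp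
  have hlim : Filter.Tendsto
      (fun β : ℝ => ∫ ω, ⨆ i, X ω i ∂P + β⁻¹ * Real.log (Fintype.card ι)) Filter.atTop
      (nhds (∫ ω, ⨆ i, X ω i ∂P + 0 * Real.log (Fintype.card ι))) :=
    (tendsto_inv_atTop_zero.mul_const _).const_add _
  rw [zero_mul, add_zero] at hlim
  exact ge_of_tendsto hlim ((Filter.eventually_gt_atTop 0).mono fun β h => hβ h)

end Comparison

/-! ### The expected maximum of independent standard Gaussians -/

/-- The first absolute moment `E|g|` of a standard Gaussian variable. -/
def gaussianAbsMean : ℝ := ∫ x, |x| ∂gaussianReal 0 1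

lemma integrable_id_gaussianReal (v : NNReal) : Integrable (fun x : ℝ => x) (gaussianReal 0 v) :=
  memLp_one_iff_integrable.1 (memLp_id_gaussianReal (μ := 0) (v := v) 1)

lemma gaussianAbsMean_pos : 0 < gaussianAbsMean := by
  refine (integral_pos_iff_support_of_nonneg (fun x => abs_nonneg x)
    (integrable_id_gaussianReal 1).abs).2 ?_
  have h1 : Function.support (fun x : ℝ => |x|) = {0}ᶜ := by ext x; simp
  have := nullSingletonClass_gaussianReal (μ := 0) (v := 1) one_ne_zero
  rw [h1, prob_compl_eq_one_sub (measurableSet_singleton 0), measure_singleton]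
  simp

lemma gaussianAbsMean_le_one : gaussianAbsMean ≤ 1 := by
  have h2 : MemLp (fun x : ℝ => x) 2 (gaussianReal 0 1) :=
    memLp_id_gaussianReal (μ := 0) (v := 1) 2
  have hv : ∫ x, x ^ 2 ∂gaussianReal 0 1 = 1 := by
    have := variance_eq_integral (X := fun x : ℝ => x) (μ := gaussianReal 0 1) (by fun_prop)
    rw [variance_fun_id_gaussianReal, integral_id_gaussianReal] at this
    simpa using this.symm
  calc gaussianAbsMean ≤ ∫ x, (1 + x ^ 2) / 2 ∂gaussianReal 0 1 := by
        refine integral_mono (integrable_id_gaussianReal 1).abs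
          (((integrable_const 1).add h2.integrable_sq).div_const 2) fun x => ?_
        have := sq_nonneg (|x| - 1)
        simp only
        nlinarith [sq_abs x]
    _ = 1 := by
        rw [integral_div, integral_add (integrable_const _) h2.integrable_sq, hv]
        simp

lemma integral_abs_of_hasGaussianLaw {Ω : Type*} [MeasurableSpace Ω] {P : Measure Ω} {D : Ω → ℝ}
    (hD : HasGaussianLaw D P) (h0 : ∫ ω, D ω ∂P = 0) :
    ∫ ω, |D ω| ∂P = gaussianAbsMean * √(∫ ω, D ω ^ 2 ∂P) := by
  have := hD.isProbabilityMeasure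
  set s := √(∫ ω, D ω ^ 2 ∂P) with hs
  have hv : Var[D; P] = s ^ 2 := by
    rw [variance_eq_integral hD.aemeasurable, h0, hs,
      Real.sq_sqrt (integral_nonneg fun ω => sq_nonneg _)]
    simp
  have hmap : P.map D = (gaussianReal 0 1).map (s * ·) := by
    rw [hD.map_eq_gaussianReal, gaussianReal_map_const_mul, h0, hv]
    congr 1
    · simp
    · ext; simp [Real.coe_toNNReal _ (sq_nonneg s)]
  calc ∫ ω, |D ω| ∂P = ∫ x, |x| ∂(P.map D) :=
        (integral_map hD.aemeasurable (by fun_prop)).symm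
    _ = ∫ x, |s * x| ∂gaussianReal 0 1 := by
        rw [hmap, integral_map (by fun_prop) (by fun_prop)]
    _ = gaussianAbsMean * s := by
        simp_rw [abs_mul]
        rw [integral_const_mul, mul_comm, abs_of_nonneg (Real.sqrt_nonneg _ : 0 ≤ s)]
        rfl

/-- Two coordinates suffice: `E max (X_i, X_j) = E|X_i - X_j| / 2`. -/
lemma gaussianAbsMean_mul_le_integral_iSup {Ω ι : Type*} [MeasurableSpace Ω] {P : Measure Ω}
    [Fintype ι] {X : Ω → ι → ℝ} (hX : HasGaussianLaw X P) (hX0 : ∀ i, ∫ ω, X ω i ∂P = 0) (i j : ι) :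
    gaussianAbsMean / 2 * √(∫ ω, (X ω i - X ω j) ^ 2 ∂P) ≤ ∫ ω, ⨆ i, X ω i ∂P := by
  have : Nonempty ι := ⟨i⟩
  have := hX.isProbabilityMeasure
  have hi (i : ι) : Integrable (fun ω => X ω i) P :=
    (memLp_two_apply_of_hasGaussianLaw hX i).integrable one_le_two
  have hD : HasGaussianLaw (fun ω => X ω i - X ω j) P :=
    hX.map_fun (ContinuousLinearMap.proj (R := ℝ) (φ := fun _ : ι => ℝ) i -
      ContinuousLinearMap.proj (R := ℝ) (φ := fun _ : ι => ℝ) j)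
  have hsub : Integrable (fun ω => |X ω i - X ω j|) P := ((hi i).sub (hi j)).abs
  have hadd : Integrable (fun ω => X ω i + X ω j) P := (hi i).add (hi j)
  have h1 := integral_abs_of_hasGaussianLaw hD (by
    rw [integral_sub (hi i) (hi j), hX0, hX0, sub_zero])
  calc gaussianAbsMean / 2 * √(∫ ω, (X ω i - X ω j) ^ 2 ∂P)
      = ∫ ω, (X ω i + X ω j + |X ω i - X ω j|) / 2 ∂P := by
        rw [integral_div, integral_add hadd hsub, integral_add (hi i) (hi j), hX0, hX0, h1]
        ring
    _ ≤ ∫ ω, ⨆ i, X ω i ∂P := by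
        refine integral_mono ((hadd.add hsub).div_const 2) (integrable_iSup_apply hi) fun ω => ?_
        have hle (i : ι) : X ω i ≤ ⨆ i, X ω i := le_ciSup (Set.finite_range (X ω)).bddAbove i
        have := hle i
        have := hle j
        simp only
        rcases abs_cases (X ω i - X ω j) with h | h <;> linarith

/-- The expected maximum of independent standard Gaussians indexed by `κ`. -/
def gaussianMax (κ : Type*) [Fintype κ] : ℝ :=
  ∫ g : κ → ℝ, ⨆ i, g i ∂Measure.pi fun _ => gaussianReal 0 1

section GaussianMax

variable {κ : Type*} [Fintype κ]

lemma hasGaussianLaw_pi_id :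
    HasGaussianLaw (fun (g : κ → ℝ) i => g i) (Measure.pi fun _ : κ => gaussianReal 0 1) := by
  have hmp (i : κ) := measurePreserving_eval (fun _ : κ => gaussianReal 0 1) i
  refine iIndepFun.hasGaussianLaw (fun i => ?_)
    (iIndepFun_pi (X := fun (_ : κ) (x : ℝ) => x) fun _ => aemeasurable_id')
  exact IsGaussian.hasGaussianLaw_id.comp_measurePreserving (hmp i)

lemma integral_pi_eval (i : κ) :
    ∫ g : κ → ℝ, g i ∂(Measure.pi fun _ : κ => gaussianReal 0 1) = 0 := by
  have := (measurePreserving_eval (fun _ : κ => gaussianReal 0 1) i).integral_comp_eq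
    (f := fun x => x) (by fun_prop)
  rw [integral_id_gaussianReal] at this
  exact this

lemma integral_pi_eval_sq (i : κ) :
    ∫ g : κ → ℝ, g i ^ 2 ∂(Measure.pi fun _ : κ => gaussianReal 0 1) = 1 := by
  have h1 := (measurePreserving_eval (fun _ : κ => gaussianReal 0 1) i).integral_comp_eq
    (f := fun x => x ^ 2) (by fun_prop)
  have h2 := variance_eq_integral (X := fun x : ℝ => x) (μ := gaussianReal 0 1) (by fun_prop)
  rw [variance_fun_id_gaussianReal, integral_id_gaussianReal] at h2
  simp only [sub_zero, NNReal.coe_one] at h2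
  rw [h2]
  exact h1

lemma integrable_pi_eval (i : κ) :
    Integrable (fun g : κ → ℝ => g i) (Measure.pi fun _ : κ => gaussianReal 0 1) :=
  (memLp_two_apply_of_hasGaussianLaw hasGaussianLaw_pi_id i).integrable one_le_two

lemma gaussianAbsMean_div_two_le_gaussianMax [Nontrivial κ] :
    gaussianAbsMean / 2 ≤ gaussianMax κ := by
  obtain ⟨i, j, hij⟩ := exists_pair_ne κ
  have h1 := gaussianAbsMean_mul_le_integral_iSup (hasGaussianLaw_pi_id (κ := κ))
    integral_pi_eval i j
  refine le_trans (le_mul_of_one_le_right (by linarith [gaussianAbsMean_pos]) ?_) h1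
  have hm (i : κ) := memLp_two_apply_of_hasGaussianLaw (hasGaussianLaw_pi_id (κ := κ)) i
  have hind : IndepFun (fun g : κ → ℝ => g i) (fun g => g j)
      (Measure.pi fun _ : κ => gaussianReal 0 1) :=
    (iIndepFun_pi (X := fun (_ : κ) (x : ℝ) => x) fun _ => aemeasurable_id').indepFun hij
  have h0 : ∫ g : κ → ℝ, g i * g j ∂(Measure.pi fun _ : κ => gaussianReal 0 1) = 0 := by
    have := hind.integral_mul_eq_mul_integral (hm i).aestronglyMeasurable
      (hm j).aestronglyMeasurable
    rw [integral_pi_eval, zero_mul] at this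
    exact this
  have h2 : ∫ g : κ → ℝ, (g i - g j) ^ 2 ∂(Measure.pi fun _ : κ => gaussianReal 0 1) = 2 := by
    have e1 : ∀ g : κ → ℝ, (g i - g j) ^ 2 = (g i ^ 2 + g j ^ 2) - 2 * (g i * g j) :=
      fun g => by ring
    have hadd : Integrable (fun g : κ → ℝ => g i ^ 2 + g j ^ 2)
        (Measure.pi fun _ : κ => gaussianReal 0 1) := (hm i).integrable_sq.add (hm j).integrable_sq
    have hmul : Integrable (fun g : κ → ℝ => 2 * (g i * g j))
        (Measure.pi fun _ : κ => gaussianReal 0 1) := ((hm i).integrable_mul (hm j)).const_mul 2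
    simp_rw [e1]
    rw [integral_sub hadd hmul, integral_const_mul, h0,
      integral_add (hm i).integrable_sq (hm j).integrable_sq, integral_pi_eval_sq,
      integral_pi_eval_sq]
    norm_num
  rw [h2]
  exact Real.one_le_sqrt.2 one_le_two

/-- The standard Gaussian density is at least its value at `t + 1` on `[t, t + 1]`. -/
lemma gaussianPDFReal_add_one_le {t : ℝ} (ht : 0 ≤ t) :
    gaussianPDFReal 0 1 (t + 1) ≤ (gaussianReal 0 1).real (Set.Ici t) := by
  have h1 : ENNReal.ofReal (gaussianPDFReal 0 1 (t + 1)) ≤ gaussianReal 0 1 (Set.Ici t) := by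
    rw [gaussianReal_apply 0 one_ne_zero]
    calc ENNReal.ofReal (gaussianPDFReal 0 1 (t + 1))
        = ∫⁻ _ in Set.Icc t (t + 1), ENNReal.ofReal (gaussianPDFReal 0 1 (t + 1)) := by simp
      _ ≤ ∫⁻ x in Set.Icc t (t + 1), gaussianPDF 0 1 x := by
          refine setLIntegral_mono (measurable_gaussianPDF 0 1) fun x hx => ?_
          refine ENNReal.ofReal_le_ofReal ?_
          simp only [gaussianPDFReal, NNReal.coe_one]
          refine mul_le_mul_of_nonneg_left (Real.exp_le_exp.2 ?_) (by positivity)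
          have := hx.1
          have := hx.2
          refine div_le_div_of_nonneg_right (neg_le_neg ?_) (by norm_num)
          nlinarith
      _ ≤ ∫⁻ x in Set.Ici t, gaussianPDF 0 1 x := lintegral_mono_set Set.Icc_subset_Ici_self
  exact (ENNReal.ofReal_le_iff_le_toReal (measure_ne_top _ _)).1 h1

/-- If the expected number of coordinates above `t` is at least one, some coordinate is above `t`
with probability at least one half. -/
lemma half_sub_one_le_gaussianMax [Nonempty κ] {t : ℝ} (ht : 0 ≤ t)
    (h : 1 ≤ Fintype.card κ * gaussianPDFReal 0 1 (t + 1)) : t / 2 - 1 ≤ gaussianMax κ := by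
  set μ := Measure.pi fun _ : κ => gaussianReal 0 1 with hμ
  set p := (gaussianReal 0 1).real (Set.Ici t) with hp
  set A : Set (κ → ℝ) := Set.pi Set.univ fun _ => Set.Iio t with hA
  have hAm : MeasurableSet A := MeasurableSet.univ_pi fun _ => measurableSet_Iio
  have hp1 : (gaussianReal 0 1).real (Set.Iio t) = 1 - p := by
    rw [hp, ← Set.compl_Iio, probReal_compl_eq_one_sub measurableSet_Iio]
    ring
  have hAp : μ.real A = (1 - p) ^ Fintype.card κ := by
    rw [measureReal_def, hμ, hA, Measure.pi_pi, ENNReal.toReal_prod, ← hp1]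
    simp [measureReal_def]
  have hp2 : 1 - p ≤ Real.exp (-p) := by linarith [Real.add_one_le_exp (-p)]
  have hp3 : 0 ≤ 1 - p := by linarith [(measureReal_le_one : p ≤ 1)]
  have hAle : μ.real A ≤ 1 / 2 := by
    calc μ.real A ≤ Real.exp (-p) ^ Fintype.card κ := hAp ▸ pow_le_pow_left₀ hp3 hp2 _
      _ = Real.exp (-(Fintype.card κ * p)) := by rw [← Real.exp_nat_mul]; congr 1; ring
      _ ≤ Real.exp (-1) := by
          refine Real.exp_le_exp.2 (neg_le_neg (h.trans ?_))
          exact mul_le_mul_of_nonneg_left (gaussianPDFReal_add_one_le ht) (by positivity)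
      _ ≤ 1 / 2 := by
          rw [Real.exp_neg, one_div]
          exact inv_anti₀ two_pos (by linarith [Real.add_one_le_exp (1 : ℝ)])
  have hAc : 1 / 2 ≤ μ.real Aᶜ := by
    rw [probReal_compl_eq_one_sub hAm]
    linarith
  obtain ⟨i₀⟩ := ‹Nonempty κ›
  have : Nonempty κ := ⟨i₀⟩
  have hind : Integrable (Aᶜ.indicator fun _ => t) μ := (integrable_const t).indicator hAm.compl
  have habs : Integrable (fun g : κ → ℝ => |g i₀|) μ := (integrable_pi_eval i₀).abs
  -- On `Aᶜ` the maximum is at least `t`, and everywhere it is at least `-|g i₀|`.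
  calc t / 2 - 1 ≤ t * μ.real Aᶜ - gaussianAbsMean := by
        nlinarith [gaussianAbsMean_le_one]
    _ = ∫ g, (Aᶜ.indicator (fun _ => t) g - |g i₀|) ∂μ := by
        rw [integral_sub hind habs, integral_indicator_const _ hAm.compl, smul_eq_mul, mul_comm t]
        congr 1
        exact ((measurePreserving_eval (fun _ : κ => gaussianReal 0 1) i₀).integral_comp_eq
          (f := fun x => |x|) (by fun_prop)).symm
    _ ≤ gaussianMax κ := by
        refine integral_mono (hind.sub habs) (integrable_iSup_apply integrable_pi_eval) fun g => ?_
        have hle (i : κ) : g i ≤ ⨆ i, g i := le_ciSup (Set.finite_range g).bddAbove i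
        by_cases hg : g ∈ A
        · simp only [Set.mem_compl_iff, hg, not_true_eq_false, not_false_eq_true,
            Set.indicator_of_notMem]
          linarith [hle i₀, neg_abs_le (g i₀)]
        · simp only [Set.mem_compl_iff, hg, not_false_eq_true, Set.indicator_of_mem]
          simp only [hA, Set.mem_univ_pi, Set.mem_Iio, not_forall, not_lt] at hg
          obtain ⟨i, hi⟩ := hg
          linarith [hle i, abs_nonneg (g i₀)]

/-- The constant in the lower bound for the maximum of independent standard Gaussians. -/
def gaussianMaxConst : ℝ := (2 + 8 / gaussianAbsMean)⁻¹

lemma gaussianMaxConst_pos : 0 < gaussianMaxConst := by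
  have := gaussianAbsMean_pos
  unfold gaussianMaxConst
  positivity

/-- The maximum of `2 ^ 2 ^ n` independent standard Gaussians is at least of order `2 ^ (n / 2)`. -/
lemma gaussianMaxConst_mul_le (n : ℕ) (h : Fintype.card κ = 2 ^ 2 ^ n) :
    gaussianMaxConst * √(2 ^ n) ≤ gaussianMax κ := by
  have hcard : 1 < Fintype.card κ := by
    rw [h]
    exact Nat.one_lt_two_pow (by positivity)
  have : Nontrivial κ := Fintype.one_lt_card_iff_nontrivial.1 hcard
  set s : ℝ := √(2 ^ n) with hs
  have hs2 : s ^ 2 = 2 ^ n := Real.sq_sqrt (by positivity)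
  have hs0 : 0 ≤ s := Real.sqrt_nonneg _
  have hm := gaussianAbsMean_pos
  have h1 := gaussianAbsMean_div_two_le_gaussianMax (κ := κ)
  -- For `s ≥ 4` the threshold `t = s - 1` is exceeded often enough; for `s < 4` the left-hand
  -- side is not positive.
  have h2 : s / 2 - 2 ≤ gaussianMax κ := by
    rcases lt_or_ge s 4 with h4 | h4
    · linarith
    have h3 : (s - 1) / 2 - 1 ≤ gaussianMax κ := by
      refine half_sub_one_le_gaussianMax (by linarith) ?_
      have hN : (Fintype.card κ : ℝ) = Real.exp (s ^ 2 * Real.log 2) := by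
        rw [h, mul_comm, Real.exp_mul, Real.exp_log two_pos, hs2]
        push_cast
        rw [← Real.rpow_natCast]
        push_cast
        rfl
      have hpi : √(2 * Real.pi) ≤ 4 := by
        rw [Real.sqrt_le_left (by norm_num)]
        linarith [Real.pi_le_four]
      have hpi0 : 0 < √(2 * Real.pi) := Real.sqrt_pos.2 (by positivity)
      have hexp : 4 ≤ Real.exp (s ^ 2 * Real.log 2 - s ^ 2 / 2) := by
        refine le_trans ?_ (Real.add_one_le_exp _)
        nlinarith [Real.log_two_gt_d9]
      simp only [gaussianPDFReal, NNReal.coe_one, mul_one, sub_add_cancel, sub_zero]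
      rw [hN, mul_left_comm, ← Real.exp_add, ← div_eq_inv_mul, le_div_iff₀ hpi0, one_mul]
      refine hpi.trans (hexp.trans_eq ?_)
      congr 1; ring
    linarith
  unfold gaussianMaxConst
  rw [inv_mul_le_iff₀ (by positivity)]
  have h3 : 4 ≤ 8 / gaussianAbsMean * gaussianMax κ := by
    rw [div_mul_eq_mul_div, le_div_iff₀ hm]
    linarith
  linarith

end GaussianMax

end GenericChaining

namespace ProbabilityTheory.IsGaussianProcess

/-! ### Gaussian processes -/

variable {T Ω : Type*} [MeasurableSpace Ω] {P : Measure Ω} {X : T → Ω → ℝ}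

lemma memLp_two (hX : IsGaussianProcess X P) (x : T) : MemLp (X x) 2 P :=
  (hX.hasGaussianLaw_eval x).memLp_two

lemma integrable (hX : IsGaussianProcess X P) (x : T) : Integrable (X x) P :=
  (hX.hasGaussianLaw_eval x).integrable

lemma hasGaussianLaw_comp (hX : IsGaussianProcess X P) {ι : Type*} [Fintype ι]
    (f : ι → T) : HasGaussianLaw (fun ω i => X (f i) ω) P := by
  classical
  let I : Finset T := Finset.univ.image f
  let L : (I → ℝ) →L[ℝ] (ι → ℝ) :=
    ContinuousLinearMap.pi fun i => ContinuousLinearMap.proj (R := ℝ) (φ := fun _ : I => ℝ)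
      ⟨f i, Finset.mem_image_of_mem f (Finset.mem_univ i)⟩
  exact (hX.hasGaussianLaw I).map_fun L

end ProbabilityTheory.IsGaussianProcess

namespace GenericChaining

/-! ### The natural metric and the Gaussian width -/

section Width

variable {T Ω : Type*} [MeasurableSpace Ω] {P : Measure Ω} {X : T → Ω → ℝ}

lemma sq_naturalDist (x y : T) : naturalDist P X x y ^ 2 = ∫ ω, (X x ω - X y ω) ^ 2 ∂P := by
  rw [naturalDist, Real.sq_sqrt (integral_nonneg fun ω => sq_nonneg _)]
  simp_rw [sq_abs]

lemma naturalDist_nonneg (x y : T) : 0 ≤ naturalDist P X x y := Real.sqrt_nonneg _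

lemma naturalDist_self (x : T) : naturalDist P X x x = 0 := by simp [naturalDist]

lemma naturalDist_comm (x y : T) : naturalDist P X x y = naturalDist P X y x := by
  simp only [naturalDist, abs_sub_comm (X x _)]

/-- The natural metric is the distance in `L²`. -/
lemma naturalDist_eq_dist (hX : IsGaussianProcess X P) (x y : T) :
    naturalDist P X x y = dist ((hX.memLp_two x).toLp (X x)) ((hX.memLp_two y).toLp (X y)) := by
  have hm := (hX.memLp_two x).sub (hX.memLp_two y)
  rw [dist_eq_norm, ← MemLp.toLp_sub, Lp.norm_toLp,
    hm.eLpNorm_eq_integral_rpow_norm (by simp) (by simp),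
    ENNReal.toReal_ofReal (by positivity), naturalDist, Real.sqrt_eq_rpow]
  simp

lemma naturalDist_triangle (hX : IsGaussianProcess X P) (x y z : T) :
    naturalDist P X x z ≤ naturalDist P X x y + naturalDist P X y z := by
  simp only [naturalDist_eq_dist hX]
  exact dist_triangle _ _ _

lemma gaussianWidth_singleton (h0 : ∀ x, ∫ ω, X x ω ∂P = 0) (x : T) :
    gaussianWidth P X {x} = 0 := by
  simp [gaussianWidth, h0]

section FiniteIndex

variable [Finite T]

lemma integrable_iSup_subtype (hX : IsGaussianProcess X P) {A : Set T} (hA : A.Nonempty) :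
    Integrable (fun ω => ⨆ x : A, X x ω) P := by
  have := Fintype.ofFinite A
  have := hA.to_subtype
  exact integrable_iSup_apply (X := fun ω (x : A) => X x ω) fun x =>
    hX.integrable x

lemma gaussianWidth_mono (hX : IsGaussianProcess X P) {A B : Set T} (hA : A.Nonempty)
    (hAB : A ⊆ B) : gaussianWidth P X A ≤ gaussianWidth P X B := by
  refine integral_mono (integrable_iSup_subtype hX hA)
    (integrable_iSup_subtype hX (hA.mono hAB)) fun ω => ?_
  have := hA.to_subtype
  exact ciSup_le fun x => le_ciSup (f := fun y : B => X y ω) (Set.finite_range _).bddAbove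
    ⟨x, hAB x.2⟩

/-- The diameter of an index set is controlled by its Gaussian width. -/
lemma gaussianAbsMean_mul_naturalDist_le (hX : IsGaussianProcess X P)
    (h0 : ∀ x, ∫ ω, X x ω ∂P = 0) {A : Set T} {x y : T} (hx : x ∈ A) (hy : y ∈ A) :
    gaussianAbsMean / 2 * naturalDist P X x y ≤ gaussianWidth P X A := by
  have := Fintype.ofFinite A
  have h1 := gaussianAbsMean_mul_le_integral_iSup
    (hX.hasGaussianLaw_comp (fun a : A => (a : T))) (fun a => h0 a) ⟨x, hx⟩ ⟨y, hy⟩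
  simpa [naturalDist, gaussianWidth, sq_abs] using h1

end FiniteIndex

/-! ### The growth condition -/

/-- The comparison process of the growth condition: on each `H i`, an independent copy of the
increments of `X` from the centre `c i`, shifted by an independent Gaussian `ρ gᵢ`. -/
def clusterProcess {κ : Type*} (X : T → Ω → ℝ) (c : κ → T) (H : κ → Set T) (ρ : ℝ)
    (q : (κ → Ω) × (κ → ℝ)) (p : Σ i, H i) : ℝ :=
  X p.2 (q.1 p.1) - X (c p.1) (q.1 p.1) + ρ * q.2 p.1

section Cluster

variable [IsProbabilityMeasure P] {κ : Type*} [Fintype κ] (c : κ → T) (H : κ → Set T) (ρ : ℝ)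

lemma measurePreserving_copy (i : κ) :
    MeasurePreserving (fun q : (κ → Ω) × (κ → ℝ) => q.1 i)
      ((Measure.pi fun _ : κ => P).prod (Measure.pi fun _ : κ => gaussianReal 0 1)) P :=
  (measurePreserving_eval (fun _ : κ => P) i).comp measurePreserving_fst

lemma measurePreserving_gaussian (i : κ) :
    MeasurePreserving (fun q : (κ → Ω) × (κ → ℝ) => q.2 i)
      ((Measure.pi fun _ : κ => P).prod (Measure.pi fun _ : κ => gaussianReal 0 1))
      (gaussianReal 0 1) :=
  (measurePreserving_eval (fun _ : κ => gaussianReal 0 1) i).comp measurePreserving_snd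

/-- Increments of the comparison process inside one cluster agree with those of `X`; across
clusters they are at most half of the separation of the centres. -/
lemma integral_sq_clusterProcess_sub_le (hX : IsGaussianProcess X P) {r : ℝ}
    (hsep : ∀ i j, i ≠ j → r ≤ naturalDist P X (c i) (c j)) (hr : 0 ≤ r)
    (hH : ∀ i, ∀ t ∈ H i, naturalDist P X t (c i) ≤ r / 8) (p q : Σ i, H i) :
    ∫ z, (clusterProcess X c H (r / 8) z p - clusterProcess X c H (r / 8) z q) ^ 2
        ∂((Measure.pi fun _ : κ => P).prod (Measure.pi fun _ : κ => gaussianReal 0 1)) ≤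
      ∫ ω, (X p.2 ω - X q.2 ω) ^ 2 ∂P := by
  obtain ⟨i, t, ht⟩ := p
  obtain ⟨j, s, hs⟩ := q
  rcases eq_or_ne i j with rfl | hij
  · refine le_of_eq ?_
    rw [← (measurePreserving_copy (P := P) i).integral_comp_eq
      (f := fun ω => (X t ω - X s ω) ^ 2)
      (((hX.integrable t).sub (hX.integrable s)).aestronglyMeasurable.pow 2)]
    congr 1; ext z
    simp only [clusterProcess]
    ring
  set μ := (Measure.pi fun _ : κ => P).prod (Measure.pi fun _ : κ => gaussianReal 0 1) with hμ
  -- The square of each of the four terms of the increment has integral at most `(r / 8) ^ 2`.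
  have hU (i : κ) (t : T) (ht : t ∈ H i) :
      Integrable (fun z : (κ → Ω) × (κ → ℝ) => (X t (z.1 i) - X (c i) (z.1 i)) ^ 2) μ ∧
        ∫ z, (X t (z.1 i) - X (c i) (z.1 i)) ^ 2 ∂μ ≤ (r / 8) ^ 2 := by
    have hint : Integrable (fun ω => (X t ω - X (c i) ω) ^ 2) P :=
      ((hX.memLp_two t).sub (hX.memLp_two (c i))).integrable_sq
    refine ⟨(measurePreserving_copy i).integrable_comp_of_integrable hint, ?_⟩
    rw [(measurePreserving_copy (P := P) i).integral_comp_eq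
      (f := fun ω => (X t ω - X (c i) ω) ^ 2) hint.aestronglyMeasurable, ← sq_naturalDist]
    exact pow_le_pow_left₀ (naturalDist_nonneg _ _) (hH i t ht) 2
  have hV (i : κ) : Integrable (fun z : (κ → Ω) × (κ → ℝ) => (r / 8 * z.2 i) ^ 2) μ ∧
      ∫ z, (r / 8 * z.2 i) ^ 2 ∂μ = (r / 8) ^ 2 := by
    have h1 := integral_pi_eval_sq i
    rw [(measurePreserving_eval (fun _ : κ => gaussianReal 0 1) i).integral_comp_eq
      (f := fun x => x ^ 2) (by fun_prop)] at h1
    have hint : Integrable (fun x : ℝ => (r / 8 * x) ^ 2) (gaussianReal 0 1) :=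
      (((memLp_id_gaussianReal (μ := 0) (v := 1) 2).const_mul (r / 8)).integrable_sq)
    refine ⟨(measurePreserving_gaussian i).integrable_comp_of_integrable hint, ?_⟩
    rw [(measurePreserving_gaussian (P := P) i).integral_comp_eq
      (f := fun x => (r / 8 * x) ^ 2) hint.aestronglyMeasurable]
    simp_rw [mul_pow]
    rw [integral_const_mul, h1, mul_one]
  obtain ⟨hi1, hi2⟩ := hU i t ht
  obtain ⟨hj1, hj2⟩ := hU j s hs
  obtain ⟨gi1, gi2⟩ := hV i
  obtain ⟨gj1, gj2⟩ := hV j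
  have hle : ∫ z, (clusterProcess X c H (r / 8) z ⟨i, t, ht⟩ -
      clusterProcess X c H (r / 8) z ⟨j, s, hs⟩) ^ 2 ∂μ ≤ (r / 2) ^ 2 := by
    have hUU : Integrable (fun z : (κ → Ω) × (κ → ℝ) => (X t (z.1 i) - X (c i) (z.1 i)) ^ 2 +
      (X s (z.1 j) - X (c j) (z.1 j)) ^ 2) μ := hi1.add hj1
    have hVV : Integrable (fun z : (κ → Ω) × (κ → ℝ) => (r / 8 * z.2 i) ^ 2 +
      (r / 8 * z.2 j) ^ 2) μ := gi1.add gj1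
    calc _ ≤ ∫ z, 4 * (((X t (z.1 i) - X (c i) (z.1 i)) ^ 2 +
          (X s (z.1 j) - X (c j) (z.1 j)) ^ 2) +
            ((r / 8 * z.2 i) ^ 2 + (r / 8 * z.2 j) ^ 2)) ∂μ := by
          refine integral_mono_of_nonneg (Filter.Eventually.of_forall fun z => sq_nonneg _)
            ((hUU.add hVV).const_mul 4) (Filter.Eventually.of_forall fun z => ?_)
          simp only [clusterProcess]
          generalize X t (z.1 i) - X (c i) (z.1 i) = a₁
          generalize X s (z.1 j) - X (c j) (z.1 j) = a₂
          generalize r / 8 * z.2 i = b₁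
          generalize r / 8 * z.2 j = b₂
          nlinarith [sq_nonneg (a₁ + a₂), sq_nonneg (b₁ + b₂), sq_nonneg ((a₁ - a₂) - (b₁ - b₂))]
      _ ≤ (r / 2) ^ 2 := by
          rw [integral_const_mul, integral_add hUU hVV, integral_add hi1 hj1,
            integral_add gi1 gj1, gi2, gj2]
          nlinarith
  refine hle.trans ?_
  rw [← sq_naturalDist]
  refine pow_le_pow_left₀ (by linarith) ?_ 2
  have h1 := naturalDist_triangle hX (c i) t (c j)
  have h2 := naturalDist_triangle hX t s (c j)
  have h3 := hsep i j hij
  have h4 := hH i t ht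
  have h5 := hH j s hs
  rw [naturalDist_comm (c i) t] at h1
  simp only
  linarith

variable [Finite T]

lemma hasGaussianLaw_clusterProcess (hX : IsGaussianProcess X P) [Fintype (Σ i, H i)] :
    HasGaussianLaw (clusterProcess X c H ρ)
      ((Measure.pi fun _ : κ => P).prod (Measure.pi fun _ : κ => gaussianReal 0 1)) := by
  have := Fintype.ofFinite T
  have hXT : HasGaussianLaw (fun ω (x : T) => X x ω) P :=
    hX.hasGaussianLaw_comp id
  have h1 : HasGaussianLaw (fun (w : κ → Ω) i (x : T) => X x (w i))
      (Measure.pi fun _ : κ => P) := by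
    refine iIndepFun.hasGaussianLaw (fun i => ?_)
      (iIndepFun_pi (X := fun (_ : κ) ω (x : T) => X x ω) fun _ => hXT.aemeasurable)
    exact hXT.comp_measurePreserving (measurePreserving_eval (fun _ : κ => P) i)
  have h2 := (indepFun_prod₀ h1.aemeasurable
    (hasGaussianLaw_pi_id (κ := κ)).aemeasurable).hasGaussianLaw
    (h1.comp_measurePreserving measurePreserving_fst)
    ((hasGaussianLaw_pi_id (κ := κ)).comp_measurePreserving measurePreserving_snd)
  let ev (i : κ) (x : T) : (κ → T → ℝ) →L[ℝ] ℝ :=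
    (ContinuousLinearMap.proj (R := ℝ) (φ := fun _ : T => ℝ) x).comp
      (ContinuousLinearMap.proj (R := ℝ) (φ := fun _ : κ => T → ℝ) i)
  let L : (κ → T → ℝ) × (κ → ℝ) →L[ℝ] ((Σ i, H i) → ℝ) :=
    ContinuousLinearMap.pi fun p => (ev p.1 p.2 - ev p.1 (c p.1)).comp
        (ContinuousLinearMap.fst ℝ (κ → T → ℝ) (κ → ℝ)) +
      ρ • (ContinuousLinearMap.proj (R := ℝ) (φ := fun _ : κ => ℝ) p.1).comp
        (ContinuousLinearMap.snd ℝ (κ → T → ℝ) (κ → ℝ))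
  exact h2.map_fun L

/-- **Growth condition** for the Gaussian width: clusters of radius `r / 8` around `r`-separated
centres contribute the maximum of independent Gaussians on top of their widths. -/
theorem gaussianWidth_growth (hX : IsGaussianProcess X P) (h0 : ∀ x, ∫ ω, X x ω ∂P = 0)
    [Nonempty κ] {r w : ℝ} (hr : 0 ≤ r)
    (hsep : ∀ i j, i ≠ j → r ≤ naturalDist P X (c i) (c j)) (hne : ∀ i, (H i).Nonempty)
    (hH : ∀ i, ∀ t ∈ H i, naturalDist P X t (c i) ≤ r / 8)
    (hw : ∀ i, w ≤ gaussianWidth P X (H i)) {A : Set T} (hA : ∀ i, H i ⊆ A) :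
    w + r / 8 * gaussianMax κ ≤ gaussianWidth P X A := by
  have := Fintype.ofFinite (Σ i, H i)
  have (i : κ) := Fintype.ofFinite (H i)
  have (i : κ) : Nonempty (H i) := (hne i).to_subtype
  have hne' : Nonempty (Σ i, H i) := nonempty_sigma.2 (‹Nonempty κ›.elim fun i => ⟨i, this i⟩)
  set π := Measure.pi fun _ : κ => P with hπ
  set γ := Measure.pi fun _ : κ => gaussianReal 0 1 with hγ
  set Y := clusterProcess X c H (r / 8) with hY
  have hYG : HasGaussianLaw Y (π.prod γ) := hasGaussianLaw_clusterProcess c H (r / 8) hX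
  have hYi (p : Σ i, H i) : Integrable (fun z => Y z p) (π.prod γ) :=
    (memLp_two_apply_of_hasGaussianLaw hYG p).integrable one_le_two
  have hcopy (i : κ) (t : T) : Integrable (fun v : κ → Ω => X t (v i)) π :=
    (measurePreserving_eval (fun _ : κ => P) i).integrable_comp_of_integrable (hX.integrable t)
  have hcopy0 (i : κ) (t : T) : ∫ v : κ → Ω, X t (v i) ∂π = 0 := by
    rw [(measurePreserving_eval (fun _ : κ => P) i).integral_comp_eq (f := X t)
      (hX.integrable t).aestronglyMeasurable, h0]
  have hY0 (p : Σ i, H i) : ∫ z, Y z p ∂(π.prod γ) = 0 := by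
    have h1 (t : T) : Integrable (fun z : (κ → Ω) × (κ → ℝ) => X t (z.1 p.1)) (π.prod γ) :=
      (hcopy p.1 t).comp_fst γ
    have h2 : Integrable (fun z : (κ → Ω) × (κ → ℝ) => z.2 p.1) (π.prod γ) :=
      (integrable_pi_eval p.1).comp_snd π
    have h3 (t : T) : ∫ z, X t (z.1 p.1) ∂(π.prod γ) = 0 := by
      rw [(measurePreserving_copy p.1).integral_comp_eq (f := X t)
        (hX.integrable t).aestronglyMeasurable, h0]
    have h4 : ∫ z, z.2 p.1 ∂(π.prod γ) = 0 := by
      rw [(measurePreserving_gaussian p.1).integral_comp_eq (f := fun x => x) (by fun_prop),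
        integral_id_gaussianReal]
    have h5 : ∫ z, (X p.2 (z.1 p.1) - X (c p.1) (z.1 p.1) + r / 8 * z.2 p.1) ∂(π.prod γ) = 0 := by
      have h6 : Integrable (fun z : (κ → Ω) × (κ → ℝ) =>
          X p.2 (z.1 p.1) - X (c p.1) (z.1 p.1)) (π.prod γ) := (h1 _).sub (h1 _)
      rw [integral_add h6 (h2.const_mul _), integral_sub (h1 _) (h1 _),
        integral_const_mul, h3, h3, h4]
      simp
    exact h5
  have hcomp : ∫ z, ⨆ p, Y z p ∂(π.prod γ) ≤ ∫ ω, ⨆ p : Σ i, H i, X p.2 ω ∂P :=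
    integral_iSup_le_of_increments_le (X := fun ω (p : Σ i, H i) => X p.2 ω)
      (hX.hasGaussianLaw_comp fun p : Σ i, H i => (p.2 : T)) hYG (fun p => h0 p.2) hY0
      (integral_sq_clusterProcess_sub_le c H hX hsep hr hH)
  have hsub : ∫ ω, ⨆ p : Σ i, H i, X p.2 ω ∂P ≤ gaussianWidth P X A := by
    obtain ⟨i⟩ := ‹Nonempty κ›
    refine integral_mono (integrable_iSup_apply (X := fun ω (p : Σ i, H i) => X p.2 ω)
      fun p => hX.integrable p.2) (integrable_iSup_subtype hX ((hne i).mono (hA i))) fun ω => ?_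
    exact ciSup_le fun p => le_ciSup (f := fun y : A => X y ω) (Set.finite_range _).bddAbove
      ⟨p.2, hA p.1 p.2.2⟩
  have hYsup : Integrable (fun z => ⨆ p, Y z p) (π.prod γ) := integrable_iSup_apply hYi
  -- Conditionally on `g`, the expected supremum dominates `w + r / 8 * gᵢ` for every `i`.
  have hlow (g : κ → ℝ) : w + r / 8 * ⨆ i, g i ≤ ∫ v, ⨆ p, Y (v, g) p ∂π := by
    have hYg (p : Σ i, H i) : Integrable (fun v => Y (v, g) p) π :=
      ((hcopy p.1 p.2).sub (hcopy p.1 (c p.1))).add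
        (integrable_const (r / 8 * g p.1))
    obtain ⟨i, hi⟩ := exists_eq_ciSup_of_finite (f := g)
    rw [← hi]
    have hsupi : Integrable (fun v : κ → Ω => ⨆ t : H i, X t (v i)) π :=
      (measurePreserving_eval (fun _ : κ => P) i).integrable_comp_of_integrable
        (integrable_iSup_subtype hX (hne i))
    have hG : ∫ v : κ → Ω, ⨆ t : H i, X t (v i) ∂π = gaussianWidth P X (H i) :=
      (measurePreserving_eval (fun _ : κ => P) i).integral_comp_eq
        (f := fun ω => ⨆ t : H i, X t ω) (integrable_iSup_subtype hX (hne i)).aestronglyMeasurable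
    have hdiff : Integrable (fun v : κ → Ω => (⨆ t : H i, X t (v i)) - X (c i) (v i)) π :=
      hsupi.sub (hcopy i (c i))
    calc w + r / 8 * g i ≤ ∫ v, ((⨆ t : H i, X t (v i)) - X (c i) (v i) + r / 8 * g i) ∂π := by
          rw [integral_add hdiff (integrable_const _), integral_sub hsupi (hcopy i (c i)), hG,
            hcopy0]
          simpa using hw i
      _ ≤ ∫ v, ⨆ p, Y (v, g) p ∂π := by
          refine integral_mono (hdiff.add (integrable_const _)) (integrable_iSup_apply hYg)
            fun v => ?_
          obtain ⟨t, ht⟩ := exists_eq_ciSup_of_finite (f := fun t : H i => X t (v i))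
          simp only
          rw [← ht]
          exact le_ciSup (f := fun p => Y (v, g) p) (Set.finite_range _).bddAbove ⟨i, t⟩
  have hgi : Integrable (fun g : κ → ℝ => w + r / 8 * ⨆ i, g i) γ :=
    (integrable_const w).add ((integrable_iSup_apply integrable_pi_eval).const_mul _)
  calc w + r / 8 * gaussianMax κ = ∫ g, (w + r / 8 * ⨆ i, g i) ∂γ := by
        rw [integral_add (integrable_const w)
          ((integrable_iSup_apply integrable_pi_eval).const_mul _), integral_const_mul]
        simp [gaussianMax]
    _ ≤ ∫ g, ∫ v, ⨆ p, Y (v, g) p ∂π ∂γ := integral_mono hgi hYsup.integral_prod_right hlow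
    _ = ∫ z, ⨆ p, Y z p ∂(π.prod γ) := (integral_prod_symm _ hYsup).symm
    _ ≤ gaussianWidth P X A := hcomp.trans hsub

end Cluster

end Width

/-! ### Nets and partitions -/

section Partition

variable {T : Type*} {d : T → T → ℝ}

/-- If `S` contains at most `N` points at mutual distance more than `r`, then `S` can be split into
`N` pieces of diameter at most `2 r`. -/
lemma exists_map_fin_dist_le [Finite T] (hself : ∀ x, d x x = 0) (hcomm : ∀ x y, d x y = d y x)
    (htri : ∀ x y z, d x z ≤ d x y + d y z) (S : Set T) {r : ℝ} (hr : 0 ≤ r) {N : ℕ} (hN : 0 < N)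
    (hcard : ∀ F : Finset T, ↑F ⊆ S → (∀ x ∈ F, ∀ y ∈ F, x ≠ y → r < d x y) → F.card ≤ N) :
    ∃ f : T → Fin N, ∀ x ∈ S, ∀ y ∈ S, f x = f y → d x y ≤ 2 * r := by
  classical
  have := Fintype.ofFinite T
  let 𝓕 : Finset (Finset T) := Finset.univ.filter fun F =>
    ↑F ⊆ S ∧ ∀ x ∈ F, ∀ y ∈ F, x ≠ y → r < d x y
  obtain ⟨F, hF, hmax⟩ := Finset.exists_max_image 𝓕 Finset.card ⟨∅, by simp [𝓕]⟩
  obtain ⟨hFS, hFsep⟩ := (Finset.mem_filter.1 hF).2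
  have hnet : ∀ x ∈ S, ∃ p ∈ F, d x p ≤ r := by
    intro x hx
    by_contra! hfar
    have hxF : x ∉ F := fun h => absurd (hfar x h) (by rw [hself]; exact not_lt.2 hr)
    have hins : insert x F ∈ 𝓕 := by
      refine Finset.mem_filter.2 ⟨Finset.mem_univ _, ?_, ?_⟩
      · rw [Finset.coe_insert]
        exact Set.insert_subset hx hFS
      · intro y hy z hz hyz
        rcases Finset.mem_insert.1 hy with hyx | hy <;> rcases Finset.mem_insert.1 hz with hzx | hz
        · exact absurd (hyx.trans hzx.symm) hyz
        · rw [hyx]; exact hfar z hz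
        · rw [hzx, hcomm]; exact hfar y hy
        · exact hFsep y hy z hz hyz
    have := hmax _ hins
    rw [Finset.card_insert_of_notMem hxF] at this
    omega
  have hemb : Nonempty (F ↪ Fin N) :=
    Function.Embedding.nonempty_of_card_le (by simpa using hcard F hFS hFsep)
  obtain ⟨e⟩ := hemb
  choose! p hpF hp using hnet
  refine ⟨fun x => if h : p x ∈ F then e ⟨p x, h⟩ else ⟨0, hN⟩, fun x hx y hy hxy => ?_⟩
  simp only [hpF x hx, hpF y hy, dite_true] at hxy
  have heq : p x = p y := by simpa using e.injective hxy
  have h1 := hp x hx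
  have h2 := hp y hy
  have h3 := htri x (p x) y
  rw [hcomm y, ← heq] at h2
  linarith

lemma encard_classes (r : Setoid T) : r.classes.encard = ENat.card (Quotient r) :=
  (ENat.card_congr (Setoid.quotientEquivClasses r)).symm

lemma encard_classes_lt_iff [Finite T] (r : Setoid T) (n : ℕ) :
    r.classes.encard < 2 ^ 2 ^ n ↔ Nat.card (Quotient r) < 2 ^ 2 ^ n := by
  rw [encard_classes, ENat.card_eq_coe_natCard]
  norm_cast

lemma card_quotient_inf_le [Finite T] (r s : Setoid T) :
    Nat.card (Quotient (r ⊓ s)) ≤ Nat.card (Quotient r) * Nat.card (Quotient s) := by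
  rw [← Nat.card_prod]
  refine Nat.card_le_card_of_injective (fun q : Quotient (r ⊓ s) =>
    (Quotient.map (sa := r ⊓ s) (sb := r) id (fun _ _ h => h.1) q,
      Quotient.map (sa := r ⊓ s) (sb := s) id (fun _ _ h => h.2) q)) ?_
  intro q q' h
  induction q using Quotient.inductionOn
  induction q' using Quotient.inductionOn
  have h1 := congrArg Prod.fst h
  have h2 := congrArg Prod.snd h
  exact Quotient.sound ⟨Quotient.exact h1, Quotient.exact h2⟩

lemma card_quotient_ker_le {β : Type*} [Finite β] (f : T → β) :
    Nat.card (Quotient (Setoid.ker f)) ≤ Nat.card β :=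
  Nat.card_le_card_of_injective _ (Setoid.kerLift_injective f)

lemma diam_le_ofReal {A : Set T} {D : ℝ} (h : ∀ x ∈ A, ∀ y ∈ A, d x y ≤ D) :
    diam d A ≤ ENNReal.ofReal D :=
  iSup₂_le fun x hx => iSup₂_le fun y hy => ENNReal.ofReal_le_ofReal (h x hx y hy)

lemma diam_ne_top {D : ℝ} (hD : ∀ x y, d x y ≤ D) (A : Set T) : diam d A ≠ ⊤ :=
  ((diam_le_ofReal fun x _ y _ => hD x y).trans_lt ENNReal.ofReal_lt_top).ne

lemma dist_le_toReal_diam {D : ℝ} (hD : ∀ x y, d x y ≤ D) {A : Set T} {x y : T} (hx : x ∈ A)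
    (hy : y ∈ A) : d x y ≤ (diam d A).toReal := by
  refine (ENNReal.ofReal_le_iff_le_toReal (diam_ne_top hD A)).1 ?_
  exact le_iSup₂_of_le x hx (le_iSup₂_of_le y hy le_rfl)

/-- Among the dyadic levels `2⁻ᵏ M` with `k ≤ n`, the last one above `s` is at most `2 s` unless it
is the finest one. -/
lemma exists_dyadic_level (n : ℕ) {s M : ℝ} (hs : 0 ≤ s) (hsM : s ≤ M) :
    ∃ k : Fin (n + 1), s ≤ (1 / 2) ^ (k : ℕ) * M ∧
      (1 / 2) ^ (k : ℕ) * M ≤ 2 * s + (1 / 2) ^ n * M := by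
  classical
  set k := Nat.findGreatest (fun k => s ≤ (1 / 2) ^ k * M) n with hk
  have hkn : k ≤ n := Nat.findGreatest_le n
  have hPk : s ≤ (1 / 2) ^ k * M :=
    Nat.findGreatest_spec (P := fun k => s ≤ (1 / 2) ^ k * M) (Nat.zero_le n) (by simpa using hsM)
  refine ⟨⟨k, Nat.lt_succ_of_le hkn⟩, hPk, ?_⟩
  rcases hkn.eq_or_lt with h | h
  · simp only [h]
    linarith
  · have h1 := Nat.findGreatest_is_greatest (P := fun k => s ≤ (1 / 2) ^ k * M)
      (Nat.lt_succ_self k) h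
    rw [Nat.succ_eq_add_one, not_le, pow_succ] at h1
    have : 0 ≤ (1 / 2 : ℝ) ^ n * M := by
      have := hs.trans hsM
      positivity
    simp only
    linarith

/-- One level of the refinement: each class of `R` is split by the dyadic level of `s`, and each
part is split by a net. -/
lemma exists_refinement [Finite T] (hself : ∀ x, d x x = 0) (hcomm : ∀ x y, d x y = d y x)
    (htri : ∀ x y z, d x z ≤ d x y + d y z) {D : ℝ} (hD : ∀ x y, d x y ≤ D) (R : Setoid T) (n : ℕ)
    {s : T → ℝ} {M a C : ℝ} (hs : ∀ x, 0 ≤ s x) (hsM : ∀ x, s x ≤ M) (ha : 0 ≤ a) (hC : 0 ≤ C)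
    {N : ℕ} (hN : 0 < N)
    (hsep : ∀ (A : Set T) (δ σ : ℝ), (∀ x ∈ A, ∀ y ∈ A, d x y ≤ δ) → (∀ x ∈ A, s x ≤ σ) →
      ∀ F : Finset T, ↑F ⊆ A → (∀ x ∈ F, ∀ y ∈ F, x ≠ y → a * δ + C * σ < d x y) → F.card ≤ N) :
    ∃ f : T → Quotient R × Fin (n + 1) × Fin N, ∀ x y z, f y = f x → f z = f x → d y z ≤
      2 * (a * (diam d {w | R w x}).toReal + C * (2 * s x + (1 / 2) ^ n * M)) := by
  choose lev hlev1 hlev2 using fun x => exists_dyadic_level n (hs x) (hsM x)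
  let S (q : Quotient R) (k : Fin (n + 1)) : Set T := {x | Quotient.mk R x = q ∧ lev x = k}
  let δ (q : Quotient R) : ℝ := (diam d {w | Quotient.mk R w = q}).toReal
  have hpiece (q : Quotient R) (k : Fin (n + 1)) : ∃ f : T → Fin N, ∀ x ∈ S q k, ∀ y ∈ S q k,
      f x = f y → d x y ≤ 2 * (a * δ q + C * ((1 / 2) ^ (k : ℕ) * M)) := by
    rcases isEmpty_or_nonempty T with hT | ⟨⟨x₀⟩⟩
    · exact ⟨fun _ => ⟨0, hN⟩, fun x => (hT.false x).elim⟩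
    have hM : 0 ≤ M := (hs x₀).trans (hsM x₀)
    refine exists_map_fin_dist_le hself hcomm htri (S q k) ?_ hN ?_
    · have : 0 ≤ δ q := ENNReal.toReal_nonneg
      positivity
    · refine hsep (S q k) _ _ (fun x hx y hy => dist_le_toReal_diam hD hx.1 hy.1) fun x hx => ?_
      rw [← hx.2]
      exact hlev1 x
  choose g hg using hpiece
  refine ⟨fun x => (Quotient.mk R x, lev x, g (Quotient.mk R x) (lev x) x), fun x y z hy hz => ?_⟩
  simp only [Prod.mk.injEq] at hy hz
  have h1 := hg (Quotient.mk R x) (lev x) y ⟨hy.1, hy.2.1⟩ z ⟨hz.1, hz.2.1⟩ (by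
    have hy2 := hy.2.2
    have hz2 := hz.2.2
    rw [hy.1, hy.2.1] at hy2
    rw [hz.1, hz.2.1] at hz2
    rw [hy2, hz2])
  have h2 : δ (Quotient.mk R x) = (diam d {w | R w x}).toReal := by
    simp only [δ, Quotient.eq]
  rw [h2] at h1
  have h3 := mul_le_mul_of_nonneg_left (hlev2 x) hC
  linarith

/-- The common refinement of the first `n + 1` partitions of a sequence. -/
def partialInf (E : ℕ → Setoid T) : ℕ → Setoid T
  | 0 => E 0
  | n + 1 => partialInf E n ⊓ E (n + 1)

lemma partialInf_le (E : ℕ → Setoid T) (n : ℕ) : partialInf E n ≤ E n := by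
  cases n with
  | zero => exact le_rfl
  | succ n => exact inf_le_right

/-- The sequence `⊤, ⊤, ⊤, R 0, R 1, …`. -/
def delay (R : ℕ → Setoid T) : ℕ → Setoid T
  | 0 => ⊤
  | 1 => ⊤
  | 2 => ⊤
  | n + 3 => R n

/-- The first `n + 1` partitions have a meet with at most `2 ^ (3 * 2 ^ (n + 1)) < 2 ^ 2 ^ (n + 3)`
elements, which is why a delay of three steps restores admissibility. -/
lemma isAdmissible_delay_partialInf [Finite T] {E : ℕ → Setoid T}
    (h : ∀ n, Nat.card (Quotient (E n)) ≤ 2 ^ (3 * 2 ^ n)) :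
    IsAdmissible (delay (partialInf E)) := by
  have htop (n : ℕ) : (⊤ : Setoid T).classes.encard < 2 ^ 2 ^ n := by
    rw [encard_classes_lt_iff]
    have : Subsingleton (Quotient (⊤ : Setoid T)) :=
      ⟨fun q q' => Quotient.inductionOn₂ q q' fun _ _ => Quotient.sound trivial⟩
    exact Finite.card_le_one_iff_subsingleton.2 this |>.trans_lt
      (Nat.one_lt_two_pow (by positivity))
  have hcard (n : ℕ) : Nat.card (Quotient (partialInf E n)) ≤ 2 ^ (3 * 2 ^ (n + 1)) := by
    induction n with
    | zero => exact (h 0).trans (Nat.pow_le_pow_right two_pos (by norm_num))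
    | succ n ih =>
      calc _ ≤ 2 ^ (3 * 2 ^ (n + 1)) * 2 ^ (3 * 2 ^ (n + 1)) :=
            (card_quotient_inf_le _ _).trans (Nat.mul_le_mul ih (h _))
        _ = _ := by rw [← pow_add]; congr 1; ring
  constructor
  · refine antitone_nat_of_succ_le fun n => ?_
    match n with
    | 0 => exact le_rfl
    | 1 => exact le_rfl
    | 2 => exact le_top
    | n + 3 => exact inf_le_left
  · intro n
    match n with
    | 0 => exact htop 0
    | 1 => exact htop 1
    | 2 => exact htop 2
    | n + 3 =>
      rw [encard_classes_lt_iff]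
      refine (hcard n).trans_lt (Nat.pow_lt_pow_right one_lt_two ?_)
      have : 0 < 2 ^ n := by positivity
      rw [pow_add, pow_add]
      omega

end Partition

/-! ### The contraction principle -/

section Contraction

variable {T : Type*} {d : T → T → ℝ}

lemma gammaTwo_eq (d : T → T → ℝ) :
    gammaTwo d = ⨅ (𝒜 : ℕ → Setoid T) (_ : IsAdmissible 𝒜),
      ⨆ x, ∑' n : ℕ, (2 : ℝ≥0∞) ^ ((n : ℝ) / 2) * diam d (cell 𝒜 n x) := by
  simp [gammaTwo, chainingFunctional]

lemma two_rpow_half (n : ℕ) : (2 : ℝ≥0∞) ^ ((n : ℝ) / 2) = ENNReal.ofReal (√2 ^ n) := by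
  have h : (2 : ℝ≥0∞) = ENNReal.ofReal 2 := by simp
  rw [h, ENNReal.ofReal_rpow_of_pos two_pos, Real.sqrt_eq_rpow, ← Real.rpow_natCast,
    ← Real.rpow_mul two_pos.le]
  congr 2
  ring

lemma sqrt_two_le : √2 ≤ 3 / 2 := (Real.sqrt_le_left (by norm_num)).2 (by norm_num)

/-- The sequence that is trivial until `n` exceeds the number of points, and consists of points from
then on, is admissible and its chaining sums have finitely many nonzero terms. -/
lemma gammaTwo_ne_top [Finite T] (hself : ∀ x, d x x = 0) {D : ℝ} (hD : ∀ x y, d x y ≤ D) :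
    gammaTwo d ≠ ⊤ := by
  classical
  obtain ⟨N, hN⟩ : ∃ N : ℕ, Nat.card T < N := exists_gt _
  set 𝒜 : ℕ → Setoid T := fun n => if n < N then ⊤ else ⊥ with h𝒜
  have hadm : IsAdmissible 𝒜 := by
    constructor
    · intro m n hmn
      by_cases hm : m < N
      · simp [h𝒜, hm]
      · simp [h𝒜, hm, show ¬ n < N by omega]
    · intro n
      rw [encard_classes_lt_iff]
      by_cases hn : n < N
      · have : Subsingleton (Quotient (⊤ : Setoid T)) :=
          ⟨fun q q' => Quotient.inductionOn₂ q q' fun _ _ => Quotient.sound trivial⟩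
        simp only [h𝒜, hn, if_true]
        exact Finite.card_le_one_iff_subsingleton.2 this |>.trans_lt
          (Nat.one_lt_two_pow (by positivity))
      · simp only [h𝒜, hn, if_false]
        have h1 : Nat.card (Quotient (⊥ : Setoid T)) ≤ Nat.card T :=
          Nat.card_le_card_of_surjective _ (Quotient.mk_surjective (s := ⊥))
        have h2 : n < 2 ^ n := Nat.lt_two_pow_self
        have h3 : 2 ^ n < 2 ^ 2 ^ n := Nat.lt_two_pow_self
        omega
  have hval (x : T) : ∑' n : ℕ, (2 : ℝ≥0∞) ^ ((n : ℝ) / 2) * diam d (cell 𝒜 n x) ≤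
      ∑ n ∈ Finset.range N, (2 : ℝ≥0∞) ^ ((n : ℝ) / 2) * ENNReal.ofReal D := by
    rw [tsum_eq_sum (s := Finset.range N)]
    · exact Finset.sum_le_sum fun n _ => mul_le_mul_right (diam_le_ofReal fun x _ y _ => hD x y) _
    · intro n hn
      have hn' : ¬ n < N := by simpa using hn
      have hcell : diam d (cell 𝒜 n x) ≤ ENNReal.ofReal 0 := by
        refine diam_le_ofReal fun y hy z hz => ?_
        have hbot : 𝒜 n = ⊥ := by simp [h𝒜, hn']
        have hy' : (𝒜 n) y x := hy
        have hz' : (𝒜 n) z x := hz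
        rw [hbot, Setoid.bot_def] at hy' hz'
        rw [hy', hz', hself]
      rw [ENNReal.ofReal_zero, nonpos_iff_eq_zero] at hcell
      rw [hcell, mul_zero]
  rw [gammaTwo_eq]
  refine ne_top_of_le_ne_top ?_ ((iInf₂_le 𝒜 hadm).trans (iSup_le hval))
  refine ENNReal.sum_ne_top.2 fun n _ => ENNReal.mul_ne_top ?_ ENNReal.ofReal_ne_top
  rw [two_rpow_half]
  exact ENNReal.ofReal_ne_top

/-- Self-improvement: an infimum bounded by half of each term plus `K` is at most `2 K`.
Finiteness is needed, since `⊤ ≤ ⊤ / 2 + K` always holds. -/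
lemma iInf_le_two_mul_of_forall_le {ι : Sort*} {f : ι → ℝ≥0∞} {K : ℝ≥0∞} (hf : ⨅ i, f i ≠ ⊤)
    (h : ∀ i, ⨅ i, f i ≤ f i / 2 + K) : ⨅ i, f i ≤ 2 * K := by
  set Γ := ⨅ i, f i with hΓ
  have h1 : 2 * (Γ - K) ≤ Γ := by
    refine le_iInf fun i => ?_
    calc 2 * (Γ - K) ≤ 2 * (f i / 2) := mul_le_mul_right (tsub_le_iff_right.2 (h i)) _
      _ = f i := ENNReal.mul_div_cancel two_ne_zero ENNReal.ofNat_ne_top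
  have h2 : Γ ≤ (Γ - K) + K := le_tsub_add
  have hfin : Γ - K ≠ ⊤ := ne_top_of_le_ne_top hf tsub_le_self
  have h3 : Γ - K ≤ K := by
    have := h1.trans h2
    rw [two_mul] at this
    exact (ENNReal.add_le_add_iff_left hfin).1 this
  calc Γ ≤ (Γ - K) + K := h2
    _ ≤ K + K := by gcongr
    _ = 2 * K := (two_mul K).symm

lemma tsum_sqrt_two_pow_mul_half_pow_le {M : ℝ} (hM : 0 ≤ M) :
    ∑' n : ℕ, ENNReal.ofReal (√2 ^ n * ((1 / 2) ^ n * M)) ≤ ENNReal.ofReal (4 * M) := by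
  have hq0 : 0 ≤ √2 / 2 := by positivity
  have hq1 : √2 / 2 < 1 := by linarith [sqrt_two_le]
  have heq (n : ℕ) : √2 ^ n * ((1 / 2) ^ n * M) = (√2 / 2) ^ n * M := by
    rw [← mul_assoc, ← mul_pow]
    congr 2
    ring
  simp_rw [heq]
  rw [← ENNReal.ofReal_tsum_of_nonneg (fun n => by positivity)
    ((summable_geometric_of_lt_one hq0 hq1).mul_right M), tsum_mul_right,
    tsum_geometric_of_lt_one hq0 hq1]
  refine ENNReal.ofReal_le_ofReal (mul_le_mul_of_nonneg_right ?_ hM)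
  rw [inv_le_comm₀ (by linarith) (by norm_num)]
  linarith [sqrt_two_le]

/-- The **contraction principle**. Suppose that separated subsets of `A` at scale
`diam A / 12 + 8 sup_A s n` have at most `2 ^ 2 ^ n` points. Splitting the cells of an admissible
sequence accordingly gives an admissible sequence whose chaining sum is at most half of the original
one, plus the sums `∑ 2 ^ (n / 2) s n x`; so `γ₂` is bounded by the latter. -/
theorem gammaTwo_le_of_separated_card_le [Finite T] (hself : ∀ x, d x x = 0)
    (hcomm : ∀ x y, d x y = d y x) (htri : ∀ x y z, d x z ≤ d x y + d y z) {D M : ℝ} (hD0 : 0 ≤ D)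
    (hD : ∀ x y, d x y ≤ D) (hM0 : 0 ≤ M) {s : ℕ → T → ℝ} (hs : ∀ n x, 0 ≤ s n x)
    (hM : ∀ x N, ∑ n ∈ Finset.range N, √2 ^ n * s n x ≤ M)
    (hsep : ∀ (n : ℕ) (A : Set T) (δ σ : ℝ), (∀ x ∈ A, ∀ y ∈ A, d x y ≤ δ) →
      (∀ x ∈ A, s n x ≤ σ) → ∀ F : Finset T, ↑F ⊆ A →
      (∀ x ∈ F, ∀ y ∈ F, x ≠ y → 1 / 12 * δ + 8 * σ < d x y) → F.card ≤ 2 ^ 2 ^ n) :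
    gammaTwo d ≤ ENNReal.ofReal (2 * (6 * D + 288 * M)) := by
  have hsM (n : ℕ) (x : T) : s n x ≤ M := by
    have h1 : √2 ^ n * s n x ≤ ∑ m ∈ Finset.range (n + 1), √2 ^ m * s m x :=
      Finset.single_le_sum (f := fun m => √2 ^ m * s m x)
        (fun m _ => mul_nonneg (by positivity) (hs m x)) (Finset.self_mem_range_succ n)
    have h2 : (1 : ℝ) ≤ √2 ^ n := one_le_pow₀ (Real.one_le_sqrt.2 one_le_two)
    exact (le_mul_of_one_le_left (hs n x) h2).trans (h1.trans (hM x (n + 1)))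
  have hK : ENNReal.ofReal (2 * (6 * D + 288 * M)) = 2 * ENNReal.ofReal (6 * D + 288 * M) := by
    rw [ENNReal.ofReal_mul two_pos.le]
    simp
  have hfin := gammaTwo_ne_top hself hD
  rw [gammaTwo_eq, iInf_subtype'] at hfin ⊢
  rw [hK]
  refine iInf_le_two_mul_of_forall_le hfin fun ⟨𝒜, h𝒜⟩ => ?_
  choose f hf using fun n => exists_refinement hself hcomm htri hD (𝒜 n) n (s := s n) (M := M)
    (a := 1 / 12) (C := 8) (hs n) (hsM n) (by norm_num) (by norm_num) (N := 2 ^ 2 ^ n)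
    (by positivity) (hsep n)
  set E : ℕ → Setoid T := fun n => Setoid.ker (f n) with hE
  have hcard (n : ℕ) : Nat.card (Quotient (E n)) ≤ 2 ^ (3 * 2 ^ n) := by
    refine (card_quotient_ker_le (f n)).trans ?_
    have h1 : Nat.card (Quotient (𝒜 n)) < 2 ^ 2 ^ n := (encard_classes_lt_iff _ _).1 (h𝒜.card_lt n)
    have h2 : n < 2 ^ n := Nat.lt_two_pow_self
    have h3 : 2 ^ n < 2 ^ 2 ^ n := Nat.lt_two_pow_self
    rw [Nat.card_prod, Nat.card_prod, Nat.card_fin, Nat.card_fin]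
    calc _ ≤ 2 ^ 2 ^ n * (2 ^ 2 ^ n * 2 ^ 2 ^ n) :=
          Nat.mul_le_mul h1.le (Nat.mul_le_mul (by omega) le_rfl)
      _ = _ := by rw [← pow_add, ← pow_add]; congr 1; ring
  set ℬ := delay (partialInf E) with hℬ
  have hadm : IsAdmissible ℬ := isAdmissible_delay_partialInf hcard
  refine (iInf_le _ (⟨ℬ, hadm⟩ : {ℬ // IsAdmissible ℬ})).trans (iSup_le fun x => ?_)
  -- The first three partitions are trivial.
  have hhead : ∑ n ∈ Finset.range 3, (2 : ℝ≥0∞) ^ ((n : ℝ) / 2) * diam d (cell ℬ n x) ≤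
      ENNReal.ofReal (6 * D) := by
    have h1 : ∀ n ∈ Finset.range 3, (2 : ℝ≥0∞) ^ ((n : ℝ) / 2) * diam d (cell ℬ n x) ≤
        ENNReal.ofReal (2 * D) := by
      intro n hn
      rw [two_rpow_half, ENNReal.ofReal_mul two_pos.le]
      refine mul_le_mul' (ENNReal.ofReal_le_ofReal ?_) (diam_le_ofReal fun x _ y _ => hD x y)
      have h2 : √2 ^ n ≤ √2 ^ 2 := pow_le_pow_right₀ (Real.one_le_sqrt.2 one_le_two)
        (by have := Finset.mem_range.1 hn; omega)
      rwa [Real.sq_sqrt two_pos.le] at h2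
    refine (Finset.sum_le_card_nsmul _ _ _ h1).trans_eq ?_
    rw [Finset.card_range, nsmul_eq_mul, ← ENNReal.ofReal_natCast, ← ENNReal.ofReal_mul (by simp)]
    congr 1
    push_cast
    ring
  have hcell (n : ℕ) : diam d (cell ℬ (n + 3) x) ≤ ENNReal.ofReal (1 / 6) * diam d (cell 𝒜 n x) +
      ENNReal.ofReal (32 * s n x + 16 * ((1 / 2) ^ n * M)) := by
    have hfin := diam_ne_top hD (cell 𝒜 n x)
    rw [← ENNReal.ofReal_toReal hfin, ← ENNReal.ofReal_mul (by norm_num),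
      ← ENNReal.ofReal_add (mul_nonneg (by norm_num) ENNReal.toReal_nonneg)
        (add_nonneg (mul_nonneg (by norm_num) (hs n x)) (by positivity))]
    refine diam_le_ofReal fun y hy z hz => ?_
    have hy' : f n y = f n x := partialInf_le E n hy
    have hz' : f n z = f n x := partialInf_le E n hz
    refine (hf n x y z hy' hz').trans_eq ?_
    simp only [cell]
    ring
  -- The delay costs a factor `√2 ^ 3 ≤ 3`, which turns `1 / 6` into the contraction factor `1 / 2`.
  have hterm (n : ℕ) : (2 : ℝ≥0∞) ^ (((n + 3 : ℕ) : ℝ) / 2) * diam d (cell ℬ (n + 3) x) ≤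
      2⁻¹ * ((2 : ℝ≥0∞) ^ ((n : ℝ) / 2) * diam d (cell 𝒜 n x)) +
        (ENNReal.ofReal (96 * (√2 ^ n * s n x)) +
          ENNReal.ofReal (√2 ^ n * ((1 / 2) ^ n * (48 * M)))) := by
    have h3 : √2 ^ (n + 3) ≤ 3 * √2 ^ n := by
      have h4 : √2 ^ 3 ≤ 3 := by
        have : √2 ^ 3 = √2 ^ 2 * √2 := by ring
        rw [this, Real.sq_sqrt two_pos.le]
        linarith [sqrt_two_le]
      rw [pow_add, mul_comm]
      exact mul_le_mul_of_nonneg_right h4 (by positivity)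
    have hinv : (2⁻¹ : ℝ≥0∞) = ENNReal.ofReal (1 / 2) := by
      rw [one_div, ENNReal.ofReal_inv_of_pos two_pos]
      simp
    rw [two_rpow_half, two_rpow_half]
    calc _ ≤ ENNReal.ofReal (3 * √2 ^ n) * (ENNReal.ofReal (1 / 6) * diam d (cell 𝒜 n x) +
          ENNReal.ofReal (32 * s n x + 16 * ((1 / 2) ^ n * M))) :=
          mul_le_mul' (ENNReal.ofReal_le_ofReal h3) (hcell n)
      _ = _ := by
          rw [mul_add, ← mul_assoc (ENNReal.ofReal _) (ENNReal.ofReal (1 / 6)), hinv,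
            ← mul_assoc (ENNReal.ofReal (1 / 2)), ← ENNReal.ofReal_mul (by positivity),
            ← ENNReal.ofReal_mul (by positivity), ← ENNReal.ofReal_mul (by norm_num),
            ← ENNReal.ofReal_add (mul_nonneg (by norm_num) (mul_nonneg (by positivity) (hs n x)))
              (by positivity)]
          congr 2
          · congr 1; ring
          · ring
  have htail : ∑' n : ℕ, (2 : ℝ≥0∞) ^ (((n + 3 : ℕ) : ℝ) / 2) * diam d (cell ℬ (n + 3) x) ≤
      2⁻¹ * ∑' n : ℕ, (2 : ℝ≥0∞) ^ ((n : ℝ) / 2) * diam d (cell 𝒜 n x) +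
        ENNReal.ofReal (288 * M) := by
    refine (ENNReal.tsum_le_tsum hterm).trans ?_
    rw [ENNReal.tsum_add, ENNReal.tsum_add, ENNReal.tsum_mul_left]
    refine add_le_add le_rfl ?_
    have h1 : ∑' n : ℕ, ENNReal.ofReal (96 * (√2 ^ n * s n x)) ≤ ENNReal.ofReal (96 * M) := by
      refine ENNReal.tsum_le_of_sum_range_le fun N => ?_
      rw [← ENNReal.ofReal_sum_of_nonneg fun n _ =>
        mul_nonneg (by norm_num) (mul_nonneg (by positivity) (hs n x)), ← Finset.mul_sum]
      exact ENNReal.ofReal_le_ofReal (mul_le_mul_of_nonneg_left (hM x N) (by norm_num))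
    refine (add_le_add h1 (tsum_sqrt_two_pow_mul_half_pow_le (by positivity))).trans_eq ?_
    rw [← ENNReal.ofReal_add (by positivity) (by positivity)]
    congr 1
    ring
  rw [← Summable.sum_add_tsum_nat_add' (k := 3) ENNReal.summable]
  refine (add_le_add hhead htail).trans ?_
  rw [ENNReal.ofReal_add (by positivity) (by positivity), ENNReal.div_eq_inv_mul]
  calc _ ≤ ENNReal.ofReal (6 * D) + (2⁻¹ * (⨆ x, ∑' n : ℕ, (2 : ℝ≥0∞) ^ ((n : ℝ) / 2) *
        diam d (cell 𝒜 n x)) + ENNReal.ofReal (288 * M)) := by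
        gcongr
        exact le_iSup (fun x => ∑' n : ℕ, (2 : ℝ≥0∞) ^ ((n : ℝ) / 2) * diam d (cell 𝒜 n x)) x
    _ = _ := by ring

end Contraction

/-! ### The interpolation functional -/

section Interpolation

variable {T Ω : Type*} [MeasurableSpace Ω] {P : Measure Ω} {X : T → Ω → ℝ}

/-- The ball of radius `t` around `x` in the natural metric. -/
def naturalBall (P : Measure Ω) (X : T → Ω → ℝ) (x : T) (t : ℝ) : Set T :=
  {y | naturalDist P X y x ≤ t}

lemma mem_naturalBall_self (x : T) {t : ℝ} (ht : 0 ≤ t) : x ∈ naturalBall P X x t := by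
  simpa [naturalBall, naturalDist_self] using ht

/-- The interpolation functional `inf_t (θ t - G(B(x, t)))` is attained. -/
lemma exists_minimizing_radius [Finite T] (θ : ℝ) (hθ : 0 ≤ θ) (x : T) :
    ∃ s, 0 ≤ s ∧ ∀ t, 0 ≤ t →
      θ * s - gaussianWidth P X (naturalBall P X x s) ≤
        θ * t - gaussianWidth P X (naturalBall P X x t) := by
  have : Nonempty T := ⟨x⟩
  obtain ⟨y₀, hy₀⟩ := Finite.exists_min fun y =>
    θ * naturalDist P X y x - gaussianWidth P X (naturalBall P X x (naturalDist P X y x))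
  refine ⟨naturalDist P X y₀ x, naturalDist_nonneg _ _, fun t ht => ?_⟩
  -- The ball of radius `t` is also the ball whose radius is the distance to its farthest point.
  obtain ⟨y, hy, hmax⟩ := (naturalBall P X x t).toFinite.exists_maximalFor
    (fun y => naturalDist P X y x) _ ⟨x, mem_naturalBall_self x ht⟩
  have hball : naturalBall P X x (naturalDist P X y x) = naturalBall P X x t := by
    ext z
    refine ⟨fun hz => ?_, fun hz => ?_⟩
    · exact (show naturalDist P X z x ≤ naturalDist P X y x from hz).trans hy
    rcases le_total (naturalDist P X z x) (naturalDist P X y x) with h | h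
    · exact h
    · exact hmax hz h
  have h1 := hy₀ y
  rw [hball] at h1
  have h2 : θ * naturalDist P X y x ≤ θ * t := mul_le_mul_of_nonneg_left hy hθ
  linarith

/-- The values of the interpolation functional at the slopes `κ 2 ^ (n / 2)` increase from at least
`-G(T)` to at most `0`, and their increments control `2 ^ (n / 2) s n`. -/
lemma sum_minimizing_radius_le {φ : ℝ → ℝ} {κ G : ℝ} (hκ : 0 ≤ κ) (hφ0 : 0 ≤ φ 0)
    (hφG : ∀ t, 0 ≤ t → φ t ≤ G) {s : ℕ → ℝ} (hs : ∀ n, 0 ≤ s n)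
    (hmin : ∀ n t, 0 ≤ t → κ * √2 ^ n * s n - φ (s n) ≤ κ * √2 ^ n * t - φ t) (N : ℕ) :
    κ / 4 * ∑ n ∈ Finset.range N, √2 ^ n * s n ≤ G := by
  have hG : 0 ≤ G := hφ0.trans (hφG 0 le_rfl)
  have hstep (N : ℕ) : κ / 4 * ∑ n ∈ Finset.range (N + 1), √2 ^ n * s n ≤
      G + (κ * √2 ^ N * s N - φ (s N)) := by
    induction N with
    | zero =>
      have h1 := hφG (s 0) (hs 0)
      have h2 := mul_nonneg hκ (hs 0)
      simp only [zero_add, Finset.sum_range_one, pow_zero, one_mul, mul_one]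
      linarith
    | succ N ih =>
      have h1 := hmin N (s (N + 1)) (hs (N + 1))
      have h2 : √2 ^ N ≤ 3 / 4 * √2 ^ (N + 1) := by
        have h3 : 4 / 3 ≤ √2 := Real.le_sqrt_of_sq_le (by norm_num)
        have h4 : 0 < √2 ^ N := by positivity
        rw [pow_succ]
        nlinarith
      have h3 : κ * √2 ^ N * s (N + 1) ≤ κ * (3 / 4 * √2 ^ (N + 1)) * s (N + 1) :=
        mul_le_mul_of_nonneg_right (mul_le_mul_of_nonneg_left h2 hκ) (hs _)
      rw [Finset.sum_range_succ, mul_add]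
      linarith
  cases N with
  | zero => simpa using hG
  | succ N =>
    have h1 := hstep N
    have h2 := hmin N 0 le_rfl
    rw [mul_zero] at h2
    linarith

lemma sqrt_pow_two (n : ℕ) : √((2 : ℝ) ^ n) = √2 ^ n := by
  rw [Real.sqrt_eq_iff_mul_self_eq (by positivity) (by positivity), ← mul_pow,
    Real.mul_self_sqrt two_pos.le]

/-- Entropy bound: a subset of `A` separated at scale `diam A / 12 + 8 sup_A s` has at most
`2 ^ 2 ^ n` points. Otherwise, the growth condition for the balls `B(x, s x)` at these points
contradicts the minimality of the radius `s x` at the point with the smallest `G(B(x, s x))`. -/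
lemma card_le_of_separated [Finite T] [IsProbabilityMeasure P] (hX : IsGaussianProcess X P)
    (h0 : ∀ x, ∫ ω, X x ω ∂P = 0) (n : ℕ) {s : T → ℝ} (hs : ∀ x, 0 ≤ s x)
    (hmin : ∀ x t, 0 ≤ t →
      gaussianMaxConst / 192 * √2 ^ n * s x - gaussianWidth P X (naturalBall P X x (s x)) ≤
        gaussianMaxConst / 192 * √2 ^ n * t - gaussianWidth P X (naturalBall P X x t))
    (A : Set T) (δ σ : ℝ) (hδ : ∀ x ∈ A, ∀ y ∈ A, naturalDist P X x y ≤ δ)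
    (hσ : ∀ x ∈ A, s x ≤ σ) (F : Finset T) (hFA : ↑F ⊆ A)
    (hF : ∀ x ∈ F, ∀ y ∈ F, x ≠ y → 1 / 12 * δ + 8 * σ < naturalDist P X x y) :
    F.card ≤ 2 ^ 2 ^ n := by
  by_contra! hcard
  obtain ⟨F', hF'F, hF'⟩ := Finset.exists_subset_card_eq hcard.le
  have h1F' : 1 < F'.card := hF' ▸ Nat.one_lt_two_pow (by positivity)
  obtain ⟨x, hx, y, hy, hxy⟩ := Finset.one_lt_card.1 h1F'
  have hA (z : F') : (z : T) ∈ A := hFA (hF'F z.2)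
  have hσ0 : 0 ≤ σ := (hs x).trans (hσ x (hA ⟨x, hx⟩))
  have hδ0 : 0 < δ := by
    have h1 := hF x (hF'F hx) y (hF'F hy) hxy
    have h2 := hδ x (hA ⟨x, hx⟩) y (hA ⟨y, hy⟩)
    linarith [naturalDist_nonneg (P := P) (X := X) x y]
  have : Nonempty F' := ⟨⟨x, hx⟩⟩
  obtain ⟨z, hz⟩ := Finite.exists_min fun z : F' => gaussianWidth P X (naturalBall P X z (s z))
  have hgrow := gaussianWidth_growth (P := P) (fun z : F' => (z : T))
    (fun z : F' => naturalBall P X z (s z)) hX h0 (r := 1 / 12 * δ + 8 * σ) (by positivity)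
    (fun i j hij => (hF i (hF'F i.2) j (hF'F j.2) fun h => hij (Subtype.ext h)).le)
    (fun i => ⟨i, mem_naturalBall_self _ (hs i)⟩)
    (fun i t ht => le_trans ht ((hσ i (hA i)).trans (by linarith))) hz
    (A := naturalBall P X z (δ + σ)) (fun i t ht => by
      have h1 := naturalDist_triangle hX t i z
      have h2 := hδ i (hA i) z (hA z)
      have h3 : naturalDist P X t i ≤ s i := ht
      have h4 := hσ i (hA i)
      show naturalDist P X t z ≤ δ + σ
      linarith)
  have hle := hmin z (δ + σ) (by positivity)
  have hmax := gaussianMaxConst_mul_le (κ := F') n (by simpa using hF')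
  rw [sqrt_pow_two] at hmax
  have hc := gaussianMaxConst_pos
  set q := gaussianMaxConst * √2 ^ n with hq
  have hq0 : 0 < q := by positivity
  have h1 : (1 / 12 * δ + 8 * σ) / 8 * q ≤ (1 / 12 * δ + 8 * σ) / 8 * gaussianMax F' :=
    mul_le_mul_of_nonneg_left hmax (by positivity)
  have h2 : gaussianMaxConst / 192 * √2 ^ n = q / 192 := by rw [hq]; ring
  rw [h2] at hle
  have h3 : 0 ≤ q / 192 * s z := mul_nonneg (by positivity) (hs z)
  have h4 : 0 < q * δ := by positivity
  have h5 : 0 ≤ q * σ := by positivity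
  nlinarith

end Interpolation

end GenericChaining

end

theorem mainTheorem2 :
    ∃ C : ℝ, 0 < C ∧
      ∀ (T : Type*) [Finite T] [Nonempty T] (Ω : Type*) [MeasurableSpace Ω]
        (P : Measure Ω) [IsProbabilityMeasure P] (X : T → Ω → ℝ),
        IsGaussianProcess X P → (∀ x, ∫ ω, X x ω ∂P = 0) →
          GenericChaining.gammaTwo (GenericChaining.naturalDist P X) ≤
            ENNReal.ofReal (C * GenericChaining.gaussianWidth P X Set.univ) := by
  open GenericChaining in
  have hm := gaussianAbsMean_pos
  have hc := gaussianMaxConst_pos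
  -- The slope `κ 2 ^ (n / 2)` is small enough for the growth condition to beat it in
  -- `card_le_of_separated`.
  set κ := gaussianMaxConst / 192 with hκ
  have hκ0 : 0 < κ := by positivity
  -- `2 / gaussianAbsMean` bounds the diameter and `4 / κ` the sums `∑ 2 ^ (n / 2) s n x`, both in
  -- units of the Gaussian width; the contraction principle combines them.
  refine ⟨2 * (6 * (2 / gaussianAbsMean) + 288 * (4 / κ)), by positivity, ?_⟩
  intro T _ _ Ω _ P _ X hX h0
  set G := gaussianWidth P X Set.univ with hG
  have hw (x : T) {t : ℝ} (ht : 0 ≤ t) : 0 ≤ gaussianWidth P X (naturalBall P X x t) := by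
    rw [← gaussianWidth_singleton h0 x]
    exact gaussianWidth_mono hX (Set.singleton_nonempty x)
      (Set.singleton_subset_iff.2 (mem_naturalBall_self x ht))
  have hwG (x : T) {t : ℝ} (ht : 0 ≤ t) : gaussianWidth P X (naturalBall P X x t) ≤ G :=
    gaussianWidth_mono hX ⟨x, mem_naturalBall_self x ht⟩ (Set.subset_univ _)
  have hG0 : 0 ≤ G := by
    obtain ⟨x⟩ := ‹Nonempty T›
    exact (hw x le_rfl).trans (hwG x le_rfl)
  choose s hs hmin using fun (n : ℕ) (x : T) =>
    exists_minimizing_radius (P := P) (X := X) (κ * √2 ^ n) (by positivity) x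
  have hD (x y : T) : naturalDist P X x y ≤ 2 / gaussianAbsMean * G := by
    have h1 := gaussianAbsMean_mul_naturalDist_le hX h0 (Set.mem_univ x) (Set.mem_univ y)
    rw [← hG] at h1
    rw [div_mul_eq_mul_div, le_div_iff₀ hm]
    linarith
  have hM (x : T) (N : ℕ) : ∑ n ∈ Finset.range N, √2 ^ n * s n x ≤ 4 / κ * G := by
    have h1 := sum_minimizing_radius_le (φ := fun t => gaussianWidth P X (naturalBall P X x t))
      hκ0.le (hw x le_rfl) (fun t ht => hwG x ht) (fun n => hs n x) (fun n => hmin n x) N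
    rw [div_mul_eq_mul_div, le_div_iff₀ hκ0]
    linarith
  refine (gammaTwo_le_of_separated_card_le naturalDist_self naturalDist_comm
    (naturalDist_triangle hX) (by positivity) hD (by positivity) hs hM fun n =>
      card_le_of_separated hX h0 n (hs n) (hmin n)).trans_eq ?_
  congr 1
  ring
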